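/- Let $\mathcal O$ be a commutative ring and $\pi\subset\mathcal O$ an invertible ideal (that is, $\pi$ is an invertible $\mathcal O$-module) such that $(\mathcal O,\pi)$ is a henselian pair. Let $G$ be a smooth separated group scheme over $\mathcal O$, and assume that $\mathcal O$ is local or that $G$ is affine. Put $G_0=G\times_{\mathcal O}\mathcal O/\pi$, let $\mathcal J=\pi\mathcal O_G\subset\mathcal O_G$ be the ideal sheaf of the closed subscheme $G_0$ of $G$, and let $\mathcal I\supseteq\mathcal J$ be the ideal sheaf of the closed subscheme of $G$ given by the trivial subgroup $\{1\}\subset G_0$, i.e. by the unit section $\operatorname{Spec}(\mathcal O/\pi)\to G_0\to G$. Let $v\colon\mathcal G\to G$ be the dilatation of $\{1\}\subset G_0$ in $G$ along $G_0$, that is, $\mathcal G$ is the relative spectrum over $G$ of the degree-zero part of $\big(\bigoplus_{n\ge 0}\mathcal I^n\big)[\mathcal J^{-1}]$; over an affine open subset $\operatorname{Spec}B$ of $G$ on which $\mathcal J$ is generated by $b$ and $\mathcal I$ is given by $I\subset B$, this is the algebra $B[\tfrac Ib]$ of all fractions $x/b^n\in B[\tfrac1b]$ with $n\ge 0$ and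 $x\in I^n$. Then there is a unique group structure on $\mathcal G(\mathcal O)$ for which the map $\mathcal G(\mathcal O)\to G(\mathcal O)$, $x\mapsto v\circ x$, is a group homomorphism, and with it the sequence of groups $$1\longrightarrow\mathcal G(\mathcal O)\longrightarrow G(\mathcal O)\longrightarrow G(\mathcal O/\pi)\longrightarrow 1,$$ whose second map is induced by $v$ and whose third map is reduction modulo $\pi$, is exact. -/

import Mathlib

open CategoryTheory AlgebraicGeometry

universe u

namespace Dilatation

section Ring

variable {B C B' C' : Type*} [CommRing B] [CommRing C] [CommRing B'] [CommRing C']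

/-- The affine blowup algebra of a ring `B` in an ideal `I` along an ideal `J ⊆ I`, viewed inside
a `B`-algebra `C`, given by `ρ : B → C`, which plays the role of the ring of functions on the
open complement of `V(J)` in `Spec B`.
It consists of the `s` with `J ^ n * s ⊆ I ^ n` for some `n`. If `J = (b)` and `C = B[1/b]`, this is
the subalgebra `B[I/b]` of `B[1/b]` of all fractions `x / b ^ n` with `x ∈ I ^ n`
(see `mem_affineBlowup_of_span_singleton`). -/
def affineBlowup (ρ : B →+* C) (I J : Ideal B) (hJI : J ≤ I) : Subring C where
  carrier := {s | ∃ n : ℕ, ∀ a ∈ J ^ n, ∃ x ∈ I ^ n, ρ a * s = ρ x}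
  mul_mem' := by
    rintro s t ⟨n, hn⟩ ⟨m, hm⟩
    refine ⟨n + m, fun a ha ↦ ?_⟩
    rw [pow_add] at ha ⊢
    induction ha using Submodule.mul_induction_on' with
    | mem_mul_mem a ha b hb =>
      obtain ⟨x, hx, ex⟩ := hn a ha
      obtain ⟨y, hy, ey⟩ := hm b hb
      exact ⟨x * y, Ideal.mul_mem_mul hx hy, by
        rw [map_mul, map_mul, ← ex, ← ey]; ring⟩
    | add a _ b _ iha ihb =>
      obtain ⟨x, hx, ex⟩ := iha
      obtain ⟨y, hy, ey⟩ := ihb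
      exact ⟨x + y, add_mem hx hy, by rw [map_add, map_add, add_mul, ex, ey]⟩
  one_mem' := ⟨0, fun a _ ↦ ⟨a, by simp, by simp⟩⟩
  add_mem' := by
    rintro s t ⟨n, hn⟩ ⟨m, hm⟩
    refine ⟨n + m, fun a ha ↦ ?_⟩
    rw [pow_add] at ha ⊢
    induction ha using Submodule.mul_induction_on' with
    | mem_mul_mem a ha b hb =>
      obtain ⟨x, hx, ex⟩ := hn a ha
      obtain ⟨y, hy, ey⟩ := hm b hb
      refine ⟨x * b + a * y, add_mem (Ideal.mul_mem_mul hx (Ideal.pow_right_mono hJI m hb))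
        (Ideal.mul_mem_mul (Ideal.pow_right_mono hJI n ha) hy), ?_⟩
      rw [map_mul, map_add, map_mul, map_mul, ← ex, ← ey]; ring
    | add a _ b _ iha ihb =>
      obtain ⟨x, hx, ex⟩ := iha
      obtain ⟨y, hy, ey⟩ := ihb
      exact ⟨x + y, add_mem hx hy, by rw [map_add, map_add, add_mul, ex, ey]⟩
  zero_mem' := ⟨0, fun a _ ↦ ⟨0, by simp, by simp⟩⟩
  neg_mem' := by
    rintro s ⟨n, hn⟩
    refine ⟨n, fun a ha ↦ ?_⟩
    obtain ⟨x, hx, ex⟩ := hn a ha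
    exact ⟨-x, neg_mem hx, by rw [map_neg, ← ex]; ring⟩

variable (ρ : B →+* C) (I J : Ideal B) (hJI : J ≤ I)

lemma mem_affineBlowup {s : C} : s ∈ affineBlowup ρ I J hJI ↔
    ∃ n : ℕ, ∀ a ∈ J ^ n, ∃ x ∈ I ^ n, ρ a * s = ρ x := Iff.rfl

/-- If `J = (b)` is principal, the elements are the fractions `x / b ^ n` with `x ∈ I ^ n`. -/
lemma mem_affineBlowup_of_span_singleton (b : B) (hb : Ideal.span {b} ≤ I) {s : C} :
    s ∈ affineBlowup ρ I (Ideal.span {b}) hb ↔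
      ∃ n : ℕ, ∃ x ∈ I ^ n, ρ b ^ n * s = ρ x := by
  rw [mem_affineBlowup]
  refine exists_congr fun n ↦ ⟨fun h ↦ ?_, ?_⟩
  · obtain ⟨x, hx, e⟩ := h (b ^ n) (by
      rw [Ideal.span_singleton_pow]; exact Ideal.mem_span_singleton_self _)
    exact ⟨x, hx, by rw [← e, map_pow]⟩
  · rintro ⟨x, hx, e⟩ a ha
    rw [Ideal.span_singleton_pow, Ideal.mem_span_singleton'] at ha
    obtain ⟨c, rfl⟩ := ha
    exact ⟨c * x, Ideal.mul_mem_left _ _ hx, by rw [map_mul, map_mul, ← e, map_pow]; ring⟩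

lemma map_mem_affineBlowup (b : B) : ρ b ∈ affineBlowup ρ I J hJI :=
  ⟨0, fun a _ ↦ ⟨a * b, by simp, by rw [map_mul]⟩⟩

/-- It suffices to test the defining condition on generators. -/
lemma test_span {n : ℕ} {t : Set B} {s : C}
    (h : ∀ a ∈ t, ∃ x ∈ I ^ n, ρ a * s = ρ x) {a : B} (ha : a ∈ Ideal.span t) :
    ∃ x ∈ I ^ n, ρ a * s = ρ x := by
  induction ha using Submodule.span_induction with
  | mem a ha => exact h a ha
  | zero => exact ⟨0, zero_mem _, by simp⟩
  | add a b _ _ iha ihb =>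
    obtain ⟨x, hx, ex⟩ := iha
    obtain ⟨y, hy, ey⟩ := ihb
    exact ⟨x + y, add_mem hx hy, by rw [map_add, map_add, add_mul, ex, ey]⟩
  | smul c a _ iha =>
    obtain ⟨x, hx, ex⟩ := iha
    exact ⟨c * x, Ideal.mul_mem_left _ _ hx, by
      rw [smul_eq_mul, map_mul, map_mul, ← ex, mul_assoc]⟩

variable {ρ I J hJI}

lemma affineBlowup_map {ρ' : B' →+* C'} {I' J' : Ideal B'} {hJI' : J' ≤ I'} (β : B →+* B')
    (γ : C →+* C') (hc : γ.comp ρ = ρ'.comp β) (hI : I.map β ≤ I') (hJ : J' ≤ J.map β) {s : C}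
    (hs : s ∈ affineBlowup ρ I J hJI) : γ s ∈ affineBlowup ρ' I' J' hJI' := by
  have hc' (b : B) : γ (ρ b) = ρ' (β b) := congr($hc b)
  obtain ⟨n, hn⟩ := hs
  refine ⟨n, fun a ha ↦ ?_⟩
  have ha' : a ∈ Ideal.span (β '' (J ^ n : Ideal B)) := by
    have := Ideal.pow_right_mono hJ n ha
    rwa [← Ideal.map_pow] at this
  refine test_span ρ' I' ?_ ha'
  rintro _ ⟨a, ha, rfl⟩
  obtain ⟨x, hx, ex⟩ := hn a ha
  refine ⟨β x, Ideal.pow_right_mono hI n ?_, by rw [← hc', ← hc', ← map_mul, ex]⟩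
  rw [← Ideal.map_pow]
  exact Ideal.mem_map_of_mem β hx

/-- Formation of the affine blowup algebra commutes with localization. -/
lemma isLocalization_affineBlowup [Algebra B B'] [Algebra C C'] (f : B)
    [IsLocalization.Away f B'] [IsLocalization.Away (ρ f) C'] {ρ' : B' →+* C'} {I' J' : Ideal B'}
    {hJI' : J' ≤ I'} (hc : (algebraMap C C').comp ρ = ρ'.comp (algebraMap B B'))
    (hI : I.map (algebraMap B B') = I') (hJ : J.map (algebraMap B B') = J') (hfg : J.FG)
    [Algebra (affineBlowup ρ I J hJI) (affineBlowup ρ' I' J' hJI')]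
    (ha : ∀ s : affineBlowup ρ I J hJI,
      (algebraMap _ (affineBlowup ρ' I' J' hJI') s : C') = algebraMap C C' s) :
    IsLocalization.Away (⟨ρ f, map_mem_affineBlowup ρ I J hJI f⟩ : affineBlowup ρ I J hJI)
      (affineBlowup ρ' I' J' hJI') := by
  have hc' (b : B) : algebraMap C C' (ρ b) = ρ' (algebraMap B B' b) := congr($hc b)
  obtain ⟨u, hu⟩ := (IsLocalization.Away.algebraMap_isUnit (S := B') f)
  refine IsLocalization.Away.mk _ ?_ ?_ ?_
  · refine IsUnit.of_mul_eq_one ⟨ρ' ↑u⁻¹, map_mem_affineBlowup _ _ _ _ _⟩ (Subtype.ext ?_)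
    simp only [MulMemClass.coe_mul, ha, hc', OneMemClass.coe_one]
    rw [← hu, ← map_mul, Units.mul_inv, map_one]
  · rintro ⟨s, n, hn⟩
    obtain ⟨k, c, hk⟩ := IsLocalization.Away.surj (ρ f) s
    have key : ∀ a ∈ J ^ n, ∃ m : ℕ, ∃ x ∈ I ^ n, ρ a * (ρ f ^ m * c) = ρ x := by
      intro a ha
      obtain ⟨x', hx', e⟩ := hn (algebraMap B B' a) (by
        rw [← hJ, ← Ideal.map_pow]; exact Ideal.mem_map_of_mem _ ha)
      rw [← hI, ← Ideal.map_pow, IsLocalization.mem_map_algebraMap_iff (.powers f)] at hx'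
      obtain ⟨⟨⟨x, hx⟩, ⟨_, k', rfl⟩⟩, hx'⟩ := hx'
      dsimp only at hx'
      have : algebraMap C C' (ρ a * (ρ f ^ k' * c)) = algebraMap C C' (ρ (x * f ^ k)) := by
        rw [map_mul, map_mul, ← hk, map_pow, hc', hc', hc', map_mul, ← hx', map_pow, map_pow,
          map_mul, map_mul, map_pow, map_pow, ← e]
        ring
      obtain ⟨l, hl⟩ := IsLocalization.Away.exists_of_eq (ρ f) this
      refine ⟨l + k', f ^ l * (x * f ^ k), Ideal.mul_mem_left _ _ (Ideal.mul_mem_right _ _ hx), ?_⟩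
      rw [map_mul, map_pow, ← hl]
      ring
    have step {m m' : ℕ} (h : m ≤ m') {a : B} (hm : ∃ x ∈ I ^ n, ρ a * (ρ f ^ m * c) = ρ x) :
        ∃ x ∈ I ^ n, ρ a * (ρ f ^ m' * c) = ρ x := by
      obtain ⟨d, rfl⟩ := Nat.exists_eq_add_of_le h
      obtain ⟨x, hx, e⟩ := hm
      exact ⟨f ^ d * x, Ideal.mul_mem_left _ _ hx, by rw [map_mul, ← e, map_pow]; ring⟩
    obtain ⟨t, ht⟩ := hfg.pow (n := n)
    have hmem (a : t) : (a : B) ∈ J ^ n := by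
      have : (a : B) ∈ Ideal.span (t : Set B) := Ideal.subset_span a.2
      rwa [ht] at this
    choose m hm using fun a : t ↦ key a (hmem a)
    have hmem' : ρ f ^ (Finset.univ.sup m) * c ∈ affineBlowup ρ I J hJI := by
      refine ⟨n, fun a ha ↦ test_span ρ I (t := t) ?_ ?_⟩
      · intro a ha
        exact step (Finset.le_sup (f := m) (Finset.mem_univ ⟨a, ha⟩)) (hm ⟨a, ha⟩)
      · rwa [← ht] at ha
    refine ⟨Finset.univ.sup m + k, ⟨_, hmem'⟩, Subtype.ext ?_⟩
    simp only [MulMemClass.coe_mul, SubmonoidClass.coe_pow, ha, map_mul, map_pow]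
    rw [← hk]
    ring
  · rintro ⟨a, hha⟩ ⟨b, hhb⟩ h
    have h' := congr_arg Subtype.val h
    rw [ha, ha] at h'
    obtain ⟨n, hn⟩ := IsLocalization.Away.exists_of_eq (ρ f) h'
    exact ⟨n, Subtype.ext (by simpa using hn)⟩

end Ring


noncomputable section Scheme

open AlgebraicGeometry.Scheme AlgebraicGeometry.Scheme.AffineZariskiSite Opposite

variable {X : Scheme.{u}} (I J : X.IdealSheafData) (hJI : J ≤ I)

/-- The open complement of the closed subscheme `V(J)`. -/
def complement : X.Opens := J.support.compl

/-- Restriction of sections. -/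
def resRingHom {U V : X.Opens} (h : U ≤ V) : Γ(X, V) →+* Γ(X, U) :=
  (X.presheaf.map (homOfLE h).op).hom

lemma resRingHom_comp {U V W : X.Opens} (h : U ≤ V) (h' : V ≤ W) :
    (resRingHom h).comp (resRingHom h') = resRingHom (h.trans h') := by
  rw [resRingHom, resRingHom, ← CommRingCat.hom_comp, ← Functor.map_comp]
  rfl

lemma resRingHom_id (U : X.Opens) : resRingHom (le_refl U) = RingHom.id _ := by
  have := X.presheaf.map_id (op U)
  exact congr($(this).hom)

/-- The sections over an affine open `U` of the affine blowup algebra of `𝒪_X` in the ideal sheaf `I`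
along the ideal sheaf `J ⊆ I`, as a subring of the ring of functions on `U ∖ V(J)`. When `J` is
locally principal this is the degree zero part of the localization at `J` of the Rees algebra
of `I`: for `J = (b)` on `U`, the functions on `U ∖ V(J)` are `Γ(X, U)[1/b]`. -/
abbrev blowupAlgebra {U : X.Opens} (hU : IsAffineOpen U) : Subring Γ(X, U ⊓ complement J) :=
  affineBlowup (resRingHom inf_le_left) (I.ideal ⟨U, hU⟩) (J.ideal ⟨U, hU⟩) (hJI ⟨U, hU⟩)

lemma map_mem_blowupAlgebra {U V : X.Opens} (hU : IsAffineOpen U) (hV : IsAffineOpen V)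
    (h : U ≤ V) {s : Γ(X, V ⊓ complement J)} (hs : s ∈ blowupAlgebra I J hJI hV) :
    resRingHom (inf_le_inf_right (complement J) h) s ∈ blowupAlgebra I J hJI hU :=
  affineBlowup_map (resRingHom h) _ (by rw [resRingHom_comp, resRingHom_comp])
    (I.map_ideal (U := ⟨U, hU⟩) (V := ⟨V, hV⟩) h).le
    (J.map_ideal (U := ⟨U, hU⟩) (V := ⟨V, hV⟩) h).ge hs

/-- The restriction maps of the affine blowup algebra. -/
def blowupRes {U V : X.Opens} (hU : IsAffineOpen U) (hV : IsAffineOpen V) (h : U ≤ V) :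
    blowupAlgebra I J hJI hV →+* blowupAlgebra I J hJI hU :=
  (resRingHom (inf_le_inf_right (complement J) h)).restrict _ _
    fun _ hs ↦ map_mem_blowupAlgebra I J hJI hU hV h hs

/-- The structure map from functions on `X` to the affine blowup algebra. -/
def blowupStr {U : X.Opens} (hU : IsAffineOpen U) : Γ(X, U) →+* blowupAlgebra I J hJI hU :=
  (resRingHom inf_le_left).codRestrict _ (map_mem_affineBlowup _ _ _ (hJI ⟨U, hU⟩))

lemma blowupRes_id {U : X.Opens} (hU : IsAffineOpen U) :
    blowupRes I J hJI hU hU le_rfl = RingHom.id _ :=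
  RingHom.ext fun s ↦ Subtype.ext congr($(resRingHom_id (U ⊓ complement J)) s.1)

lemma blowupRes_comp {U V W : X.Opens} (hU : IsAffineOpen U) (hV : IsAffineOpen V)
    (hW : IsAffineOpen W) (h : U ≤ V) (h' : V ≤ W) :
    (blowupRes I J hJI hU hV h).comp (blowupRes I J hJI hV hW h') =
      blowupRes I J hJI hU hW (h.trans h') :=
  RingHom.ext fun s ↦ Subtype.ext congr($(resRingHom_comp
    (inf_le_inf_right (complement J) h) (inf_le_inf_right (complement J) h')) s.1)

lemma blowupRes_comp_blowupStr {U V : X.Opens} (hU : IsAffineOpen U) (hV : IsAffineOpen V)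
    (h : U ≤ V) : (blowupRes I J hJI hU hV h).comp (blowupStr I J hJI hV) =
      (blowupStr I J hJI hU).comp (resRingHom h) :=
  RingHom.ext fun s ↦ Subtype.ext <| by
    change (resRingHom _).comp (resRingHom _) s = (resRingHom _).comp (resRingHom _) s
    rw [resRingHom_comp, resRingHom_comp]

/-- The affine blowup algebra as a presheaf on affine opens (with basic open inclusions). -/
def blowupFunctor : X.AffineZariskiSiteᵒᵖ ⥤ CommRingCat.{u} where
  obj U := .of (blowupAlgebra I J hJI U.unop.2)
  map {V U} i := CommRingCat.ofHom (blowupRes I J hJI U.unop.2 V.unop.2 (toOpens_mono i.unop.le))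
  map_id U := by
    rw [blowupRes_id]; rfl
  map_comp {U V W} i j := by
    rw [← CommRingCat.ofHom_comp, blowupRes_comp]

/-- The affine blowup algebra is an algebra over the structure sheaf. -/
def blowupMap : (toOpensFunctor X).op ⋙ X.presheaf ⟶ blowupFunctor I J hJI where
  app U := CommRingCat.ofHom (blowupStr I J hJI U.unop.2)
  naturality {V U} i := CommRingCat.hom_ext
    (blowupRes_comp_blowupStr I J hJI U.unop.2 V.unop.2 (toOpens_mono i.unop.le)).symm

variable {J}

lemma isCompact_inf_complement {U : X.Opens} (hU : IsAffineOpen U) (hJ : (J.ideal ⟨U, hU⟩).FG) :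
    IsCompact (U ⊓ complement J).1 := by
  obtain ⟨t, ht⟩ := hJ
  have : (U ⊓ complement J).1 = ⋃ a ∈ t, (X.basicOpen a : Set X) := by
    ext x
    simp only [Set.mem_iUnion]
    by_cases hx : x ∈ U
    · have h1 : x ∈ (U ⊓ complement J).1 ↔ x ∉ J.support := by
        simp only [TopologicalSpace.Opens.carrier_eq_coe, SetLike.mem_coe,
          TopologicalSpace.Opens.mem_inf, hx, true_and]
        rfl
      rw [h1, J.mem_support_iff_of_mem (U := ⟨U, hU⟩) hx, ← ht, Ideal.span, zeroLocus_span]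
      simp
    · have h1 : x ∉ (U ⊓ complement J).1 := fun h ↦ hx h.1
      simp only [h1, false_iff, not_exists]
      exact fun a _ h ↦ hx (X.basicOpen_le a h)
  rw [this]
  exact t.finite_toSet.isCompact_biUnion fun a _ ↦ (hU.basicOpen a).isCompact

lemma isLocalization_blowup (hJ : ∀ U : X.affineOpens, (J.ideal U).FG) {U V : X.Opens}
    (hV : IsAffineOpen V) (f : Γ(X, V)) (hU : IsAffineOpen U) (e : U = X.basicOpen f) :
    letI := (blowupRes I J hJI hU hV (e.trans_le (X.basicOpen_le f))).toAlgebra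
    IsLocalization.Away (blowupStr I J hJI hV f) (blowupAlgebra I J hJI hU) := by
  subst e
  let : Algebra Γ(X, V) Γ(X, X.basicOpen f) := (resRingHom (X.basicOpen_le f)).toAlgebra
  let : Algebra Γ(X, V ⊓ complement J) Γ(X, X.basicOpen f ⊓ complement J) :=
    (resRingHom (inf_le_inf_right (complement J) (X.basicOpen_le f))).toAlgebra
  let : Algebra (blowupAlgebra I J hJI hV) (blowupAlgebra I J hJI hU) :=
    (blowupRes I J hJI hU hV (X.basicOpen_le f)).toAlgebra
  have h1 : IsLocalization.Away f Γ(X, X.basicOpen f) := hV.isLocalization_basicOpen f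
  have h2 : IsLocalization.Away (resRingHom inf_le_left f : Γ(X, V ⊓ complement J))
      Γ(X, X.basicOpen f ⊓ complement J) := by
    have key := isLocalization_basicOpen_of_qcqs (isCompact_inf_complement hV (hJ ⟨V, hV⟩))
      (hV.isQuasiSeparated.of_subset inf_le_left)
      (resRingHom inf_le_left f : Γ(X, V ⊓ complement J))
    have gen (W : X.Opens) (hW : W ≤ V ⊓ complement J)
        (e : X.basicOpen (resRingHom inf_le_left f : Γ(X, V ⊓ complement J)) = W) :
        letI := (resRingHom hW).toAlgebra
        IsLocalization.Away (resRingHom inf_le_left f : Γ(X, V ⊓ complement J)) Γ(X, W) := by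
      subst e
      exact key
    refine gen _ (inf_le_inf_right (complement J) (X.basicOpen_le f)) ?_
    have e : X.basicOpen (resRingHom inf_le_left f : Γ(X, V ⊓ complement J)) =
        X.basicOpen f ⊓ complement J := by
      refine (X.basicOpen_res f (homOfLE inf_le_left).op).trans ?_
      refine le_antisymm ?_ ?_
      · exact le_inf inf_le_right (inf_le_left.trans inf_le_right)
      · exact le_inf (inf_le_inf_right _ (X.basicOpen_le f)) inf_le_left
    exact e
  exact isLocalization_affineBlowup (ρ := resRingHom inf_le_left)
    (ρ' := resRingHom inf_le_left) f
    (by exact (resRingHom_comp _ _).trans (resRingHom_comp _ _).symm)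
    (I.map_ideal (U := ⟨X.basicOpen f, hU⟩) (V := ⟨V, hV⟩) (X.basicOpen_le f))
    (J.map_ideal (U := ⟨X.basicOpen f, hU⟩) (V := ⟨V, hV⟩) (X.basicOpen_le f))
    (hJ ⟨V, hV⟩) fun s ↦ rfl

/-- The affine blowup algebra is a quasi-coherent algebra: its sections over `D(f)` are the
localization at `f` of the sections over `U`. -/
lemma blowupMap_coequifibered (hJ : ∀ U : X.affineOpens, (J.ideal U).FG) :
    (blowupMap I J hJI).Coequifibered :=
  coequifibered_iff_forall_isLocalizationAway.mpr fun U f ↦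
    isLocalization_blowup I hJI hJ U.2 f (U.2.basicOpen f) rfl

variable (J)

/-- The dilatation of `X` in `V(I)` along `V(J)`: the relative spectrum over `X` of the affine
blowup algebra, glued from the spectra of its sections over the affine opens of `X`.
(The finiteness of `J` is automatic if `J` is locally principal.) -/
def dilatation (hJ : ∀ U : X.affineOpens, (J.ideal U).FG) : Scheme.{u} :=
  (relativeGluingData (blowupMap_coequifibered I hJI hJ)).glued

/-- The structure morphism of the dilatation. -/
def dilatationMap (hJ : ∀ U : X.affineOpens, (J.ideal U).FG) : dilatation I J hJI hJ ⟶ X :=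
  (relativeGluingData (blowupMap_coequifibered I hJI hJ)).toBase

end Scheme

noncomputable section NeronBlowup

open MonObj

variable {O : Type u} [CommRing O] (π : Ideal O) (G : Over (Spec (.of O)))

/-- `Spec O` as a scheme over itself; morphisms from it to `G` over `Spec O` form `G(O)`. -/
abbrev baseScheme (O : Type u) [CommRing O] : Over (Spec (.of O)) := Over.mk (𝟙 (Spec (.of O)))

/-- `Spec (O / π)` as a scheme over `Spec O`; morphisms from it to `G` form `G(O / π)`. -/
abbrev quotScheme : Over (Spec (.of O)) :=
  Over.mk (Spec.map (CommRingCat.ofHom (Ideal.Quotient.mk π)))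

/-- The closed immersion `Spec (O / π) → Spec O`. -/
def quotMap : quotScheme π ⟶ baseScheme O :=
  Over.homMk (Spec.map (CommRingCat.ofHom (Ideal.Quotient.mk π)))

/-- The structure map from `O` to the global functions on `G`. -/
def globalScalars : O →+* Γ(G.left, ⊤) :=
  ((Scheme.ΓSpecIso (.of O)).inv ≫ G.hom.appTop).hom

/-- The ideal sheaf `π 𝒪_G` of the closed subscheme `G ×_O O/π` of `G`. -/
def fibreIdeal : G.left.IdealSheafData :=
  Scheme.IdealSheafData.ofIdealTop (π.map (globalScalars G))

/-- The ideal sheaf in `𝒪_G` of the trivial subgroup of `G ×_O O/π`, that is the kernel of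
`𝒪_G → e_* 𝒪` where `e : Spec (O / π) → G` is the unit of the group `G(O / π)`. -/
def unitIdeal [GrpObj G] : G.left.IdealSheafData :=
  Scheme.Hom.ker (1 : quotScheme π ⟶ G).left

lemma scalars_eq_zero (f : quotScheme π ⟶ G) {a : O} (ha : a ∈ π) :
    f.left.appTop.hom (globalScalars G a) = 0 := by
  have h1 : (Scheme.ΓSpecIso (.of O)).inv ≫ G.hom.appTop ≫ f.left.appTop =
      CommRingCat.ofHom (Ideal.Quotient.mk π) ≫ (Scheme.ΓSpecIso (.of (O ⧸ π))).inv := by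
    have h2 := congr(Scheme.Hom.appTop $(Over.w f))
    rw [Scheme.Hom.comp_appTop] at h2
    rw [h2]
    exact (Scheme.ΓSpecIso_inv_naturality _).symm
  have h3 := congr($(h1).hom a)
  refine h3.trans ?_
  change (Scheme.ΓSpecIso (.of (O ⧸ π))).inv.hom (Ideal.Quotient.mk π a) = 0
  rw [Ideal.Quotient.eq_zero_iff_mem.mpr ha, map_zero]

lemma fibreIdeal_le_unitIdeal [GrpObj G] : fibreIdeal π G ≤ unitIdeal π G := by
  refine Scheme.IdealSheafData.le_ofIdeals_iff.mpr fun U ↦ ?_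
  rw [fibreIdeal, Scheme.IdealSheafData.ofIdealTop_ideal, Ideal.map_map, Ideal.map_le_iff_le_comap]
  intro a ha
  have h := scalars_eq_zero π G (1 : quotScheme π ⟶ G) ha
  change ((G.left.presheaf.map _) ≫ (1 : quotScheme π ⟶ G).left.app U.1).hom
    (globalScalars G a) = 0
  rw [Scheme.Hom.naturality, CommRingCat.hom_comp, RingHom.comp_apply]
  erw [h]
  exact map_zero _

lemma fibreIdeal_fg (hπ : π.FG) (U : G.left.affineOpens) : ((fibreIdeal π G).ideal U).FG :=
  (hπ.map _).map _

lemma fg_of_invertible [Module.Invertible O π] : π.FG :=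
  Module.Finite.iff_fg.mp (inferInstanceAs (Module.Finite O π))

/-- The dilatation of the trivial subgroup of `G ×_O O/π` in `G`, as a scheme over `Spec O`. -/
def neronBlowup [Module.Invertible O π] [GrpObj G] : Over (Spec (.of O)) :=
  Over.mk (dilatationMap (unitIdeal π G) (fibreIdeal π G) (fibreIdeal_le_unitIdeal π G)
    (fibreIdeal_fg π G (fg_of_invertible π)) ≫ G.hom)

/-- The canonical morphism from the dilatation to `G`. -/
def neronBlowupMap [Module.Invertible O π] [GrpObj G] : neronBlowup π G ⟶ G :=
  Over.homMk (dilatationMap (unitIdeal π G) (fibreIdeal π G) (fibreIdeal_le_unitIdeal π G)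
    (fibreIdeal_fg π G (fg_of_invertible π)))

/-- The reduction homomorphism `G(O) → G(O / π)`. -/
def reduction [GrpObj G] : (baseScheme O ⟶ G) →* (quotScheme π ⟶ G) :=
  MonoidHom.mk' (fun x ↦ quotMap π ≫ x) fun x y ↦ comp_mul _ x y

end NeronBlowup

end Dilatation

open MonObj Dilatation

/-! Injectivity and the image of the second map come from the universal property of the dilatation,
tested on points over `O`. Since `O` is local or `G` is affine, a point `z` factors through an
affine open `U` of `G`, so it is a section `β` of `O → Γ(G, U)`. Lifts of `z` to the dilatation are
extensions of `β` to the affine blowup algebra. On a fraction with denominators in `π ^ n`, such an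
extension must send `s` to an `r` with `q * r` prescribed for all `q ∈ π ^ n`. As `π` is invertible,
there is at most one such `r` (`affineBlowup_hom_ext`). It exists once `β` maps the ideal of the
centre into `π` (`exists_affineBlowup_hom`), because endomorphisms of `π ^ n` are scalars. That
condition is also necessary (`section_mem_of_blowupAlgebra_hom`), and by `eq_one_iff` it says that
`z` reduces to the unit modulo `π`. The points of the dilatation are thus in bijection with the
kernel of reduction, which carries the group structure over; injectivity makes it unique.

Surjectivity is the lifting of sections of smooth algebras along a henselian pair
(`exists_algHom_lift_of_smooth`). For étale algebras, Zariski's main theorem reduces to a finite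
algebra, where a root of a characteristic polynomial yields an idempotent splitting off a copy of
the base. This gives Hensel's lemma for square systems of polynomials. A smooth algebra need not be
given by a square system; its formal smoothness supplies a matrix that turns its equations into a
square system with Jacobian `1`, and Nakayama's lemma shows that a solution of the new system solves
the old one. -/

section EtaleLift

/-! ### Lifting sections of étale algebras. -/

open Polynomial

variable {R B C T : Type*} [CommRing R] [CommRing B] [CommRing C] [CommRing T]
  [Algebra R B] [Algebra R C] [Algebra R T]

/-- A form of the main theorem of Zariski along a section of a quasi-finite algebra. -/
lemma exists_isIntegral_forall_isIntegral_pow_mul [Algebra.FiniteType R C]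
    [Algebra.QuasiFinite R C] (σ : C →ₐ[R] T) (hT : Function.Surjective (algebraMap R T)) :
    ∃ g : C, σ g = 1 ∧ IsIntegral R g ∧ ∀ x, ∃ m, IsIntegral R (g ^ m * x) := by
  let D := integralClosure R C
  let colon (x : C) : Ideal D :=
    { carrier := {r | IsIntegral R (r.1 * x)}
      add_mem' := fun {a b} ha hb ↦ by
        simpa [add_mul] using IsIntegral.add ha hb
      zero_mem' := by simpa using isIntegral_zero
      smul_mem' := fun c a ha ↦ by
        simpa [_root_.mul_assoc] using IsIntegral.mul c.2 ha }
  -- The radicals of all conductors are intersected, since the exponent may vary with `x`.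
  let 𝔤 : Ideal D := ⨅ x, (colon x).radical
  have mem𝔤 (r : D) : r ∈ 𝔤 ↔ ∀ x, ∃ m, IsIntegral R (r.1 ^ m * x) := by
    simp only [𝔤, Ideal.mem_iInf, Ideal.mem_radical_iff]
    exact Iff.rfl
  let κ : D →+* T := (σ : C →+* T).comp (D.val : D →+* C)
  have hκ : Function.Surjective κ := fun t ↦ by
    obtain ⟨r, rfl⟩ := hT t
    exact ⟨algebraMap R D r, by simp [κ]⟩
  -- If the image lay in a maximal ideal `M`, Zariski's main theorem at the preimage of `M` in `C`
  -- would give an element of `𝔤` outside that preimage.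
  have htop : 𝔤.map κ = ⊤ := by
    by_contra h
    obtain ⟨M, hM, hle⟩ := Ideal.exists_le_maximal _ h
    let p : Ideal C := M.comap (σ : C →+* T)
    have : p.IsPrime := Ideal.comap_isPrime _ _
    obtain ⟨r, hr, hri, hrx⟩ := Algebra.zariskisMainProperty_iff.mp
      (Algebra.ZariskisMainProperty.of_finiteType (R := R) p)
    exact hr (hle (Ideal.mem_map_of_mem κ ((mem𝔤 ⟨r, hri⟩).mpr hrx)))
  obtain ⟨g, hg, e⟩ := (Ideal.mem_map_iff_of_surjective κ hκ).mp
    (htop ▸ Submodule.mem_top : (1 : T) ∈ 𝔤.map κ)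
  exact ⟨g, e, g.2, (mem𝔤 g).mp hg⟩

/-- Adjoining `g` and one integral multiple `g ^ m * x` of each of finitely many generators of `C`
suffices. Geometrically, a neighbourhood of the section in `Spec C` is open in the spectrum of a
finite algebra: `D` and `C` agree after inverting `g`. -/
lemma exists_finite_subalgebra_forall_pow_mul_mem [Algebra.FiniteType R C]
    [Algebra.QuasiFinite R C] (σ : C →ₐ[R] T) (hT : Function.Surjective (algebraMap R T)) :
    ∃ (D : Subalgebra R C) (_ : Module.Finite R D) (g : D), σ g = 1 ∧
      ∀ x, ∃ m, (g ^ m * x : C) ∈ D := by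
  obtain ⟨g, hg, hgi, hgx⟩ := exists_isIntegral_forall_isIntegral_pow_mul σ hT
  obtain ⟨s, hs⟩ := Algebra.FiniteType.out (R := R) (A := C)
  choose m hm using hgx
  let t := insert g ((fun x ↦ g ^ m x * x) '' (s : Set C))
  have hfg : (Subalgebra.toSubmodule (Algebra.adjoin R t)).FG := by
    refine fg_adjoin_of_finite ((s.finite_toSet.image _).insert g) ?_
    rintro a (rfl | ⟨x, hx, rfl⟩)
    exacts [hgi, hm x]
  have hgD : g ∈ Algebra.adjoin R t := Algebra.subset_adjoin (Set.mem_insert _ _)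
  refine ⟨Algebra.adjoin R t, ⟨(Submodule.fg_top _).mpr hfg⟩, ⟨g, hgD⟩, hg, fun x ↦ ?_⟩
  have hx : x ∈ Algebra.adjoin R (s : Set C) := hs ▸ Algebra.mem_top
  induction hx using Algebra.adjoin_induction with
  | mem x hx => exact ⟨m x, Algebra.subset_adjoin (Set.mem_insert_of_mem _ ⟨x, hx, rfl⟩)⟩
  | algebraMap r => exact ⟨0, by simp⟩
  | add x y _ _ hx hy =>
    obtain ⟨a, ha⟩ := hx
    obtain ⟨b, hb⟩ := hy
    refine ⟨a + b, ?_⟩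
    have : g ^ (a + b) * (x + y) = g ^ b * (g ^ a * x) + g ^ a * (g ^ b * y) := by ring
    exact this ▸ add_mem (mul_mem (pow_mem hgD _) ha) (mul_mem (pow_mem hgD _) hb)
  | mul x y _ _ hx hy =>
    obtain ⟨a, ha⟩ := hx
    obtain ⟨b, hb⟩ := hy
    refine ⟨a + b, ?_⟩
    have : g ^ (a + b) * (x * y) = (g ^ a * x) * (g ^ b * y) := by ring
    exact this ▸ mul_mem ha hb

/-- The kernel of a section of a formally unramified algebra is idempotent. -/
lemma ker_le_sq_sup_of_formallyUnramified [Algebra.FormallyUnramified R C] (σ : C →ₐ[R] T)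
    (hT : Function.Surjective (algebraMap R T)) :
    RingHom.ker σ ≤ RingHom.ker σ ^ 2 ⊔ (RingHom.ker (algebraMap R T)).map (algebraMap R C) := by
  set L := RingHom.ker σ ^ 2 ⊔ (RingHom.ker (algebraMap R T)).map (algebraMap R C) with hL
  have hker : RingHom.ker (Algebra.ofId R T).toRingHom ≤
      RingHom.ker (Algebra.ofId R (C ⧸ L)).toRingHom := fun r hr ↦ by
    have : (Ideal.Quotient.mk L) (algebraMap R C r) = 0 := Ideal.Quotient.eq_zero_iff_mem.mpr
      (Ideal.mem_sup_right (Ideal.mem_map_of_mem _ hr))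
    exact this
  let s : T →ₐ[R] C ⧸ L := AlgHom.liftOfSurjective (Algebra.ofId R T) hT (Algebra.ofId R _) hker
  have hs (r : R) : s (algebraMap R T r) = Ideal.Quotient.mk L (algebraMap R C r) := s.commutes r
  have hnil : IsNilpotent ((RingHom.ker σ).map (Ideal.Quotient.mk L)) := by
    refine ⟨2, ?_⟩
    rw [← Ideal.map_pow, Ideal.zero_eq_bot, Ideal.map_eq_bot_iff_le_ker, Ideal.mk_ker]
    exact le_sup_left
  -- Both maps `C → C ⧸ L` agree modulo the image of the kernel of `σ`, whose square is zero.
  have key : Ideal.Quotient.mkₐ R L = s.comp σ := by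
    refine Algebra.FormallyUnramified.ext _ hnil fun x ↦ ?_
    obtain ⟨r, hr⟩ := hT (σ x)
    rw [AlgHom.comp_apply, ← hr, hs, Ideal.Quotient.eq]
    change Ideal.Quotient.mk L x - _ ∈ _
    rw [← map_sub]
    refine Ideal.mem_map_of_mem _ ?_
    rw [RingHom.mem_ker, map_sub, AlgHom.commutes, hr, sub_self]
  intro x hx
  rw [← Ideal.Quotient.eq_zero_iff_mem]
  have := congr($key x)
  rw [AlgHom.comp_apply, hx, map_zero] at this
  exact this

/-- A section of a finite algebra whose kernel is idempotent modulo `π` is cut out modulo `π` by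
an idempotent. -/
lemma exists_mul_mem_map_of_ker_le_sq_sup (π : Ideal R) [Module.Finite R B]
    (σ : B →ₐ[R] R ⧸ π) (h : RingHom.ker σ ≤ RingHom.ker σ ^ 2 ⊔ π.map (algebraMap R B)) :
    ∃ b, σ b = 1 ∧ ∀ k, σ k = 0 → b * k ∈ π.map (algebraMap R B) := by
  let L := π.map (algebraMap R B)
  have hLk : L ≤ RingHom.ker σ := by
    rw [Ideal.map_le_iff_le_comap]
    intro r hr
    rw [Ideal.mem_comap, RingHom.mem_ker, AlgHom.commutes]
    exact Ideal.Quotient.eq_zero_iff_mem.mpr hr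
  let K := (RingHom.ker σ).map (Ideal.Quotient.mk L)
  have hK : IsIdempotentElem K := by
    refine le_antisymm Ideal.mul_le_left ?_
    have := Ideal.map_mono (f := Ideal.Quotient.mk L) h
    rw [Ideal.map_sup, Ideal.map_quotient_self, sup_bot_eq, Ideal.map_pow, sq] at this
    exact this
  -- Subtracting scalars from module generators of `B` gives ideal generators of `K`; an idempotent
  -- ideal is generated by an idempotent only if it is finitely generated.
  have hfg : K.FG := by
    obtain ⟨n, s, hs⟩ := Module.Finite.exists_fin (R := R) (M := B)
    choose o ho using fun i ↦ Ideal.Quotient.mk_surjective (σ (s i))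
    refine ⟨(Set.finite_range fun i ↦
      Ideal.Quotient.mk L (s i - algebraMap R B (o i))).toFinset, le_antisymm ?_ ?_⟩
    · rw [Ideal.span_le]
      intro x hx
      simp only [Set.Finite.coe_toFinset, Set.mem_range] at hx
      obtain ⟨i, rfl⟩ := hx
      refine Ideal.mem_map_of_mem _ ?_
      rw [RingHom.mem_ker, map_sub, AlgHom.commutes, ← ho]
      exact sub_self _
    · rw [Ideal.map_le_iff_le_comap]
      intro x hx
      obtain ⟨c, rfl⟩ := (Submodule.mem_span_range_iff_exists_fun R).mp
        (hs ▸ Submodule.mem_top : x ∈ Submodule.span R (Set.range s))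
      have e1 : ∑ i, c i • s i = ∑ i, c i • (s i - algebraMap R B (o i)) +
          algebraMap R B (∑ i, c i * o i) := by
        simp [mul_sub, Algebra.smul_def]
      have e2 : ∑ i, c i * o i ∈ π := by
        rw [← Ideal.Quotient.eq_zero_iff_mem, map_sum]
        rw [RingHom.mem_ker, map_sum] at hx
        rw [← hx]
        refine Finset.sum_congr rfl fun i _ ↦ ?_
        rw [map_smul, ← ho, map_mul]
        rfl
      have e3 : Ideal.Quotient.mk L (algebraMap R B (∑ i, c i * o i)) = 0 :=
        Ideal.Quotient.eq_zero_iff_mem.mpr (Ideal.mem_map_of_mem _ e2)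
      rw [Ideal.mem_comap, e1, map_add, e3, add_zero, map_sum]
      refine Ideal.sum_mem _ fun i _ ↦ ?_
      rw [Algebra.smul_def, map_mul]
      exact Ideal.mul_mem_left _ _ (Ideal.subset_span (by simp))
  obtain ⟨ε, hε, hKε⟩ := (Ideal.isIdempotentElem_iff_of_fg K hfg).mp hK
  obtain ⟨x, hx, rfl⟩ := (Ideal.mem_map_iff_of_surjective _ Ideal.Quotient.mk_surjective).mp
    (hKε ▸ Ideal.mem_span_singleton_self ε : ε ∈ K)
  refine ⟨1 - x, by rw [map_sub, map_one, hx, sub_zero], fun k hk ↦ ?_⟩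
  have hkK : Ideal.Quotient.mk L k ∈ K := Ideal.mem_map_of_mem _ hk
  rw [hKε] at hkK
  obtain ⟨c, hc⟩ := Ideal.mem_span_singleton'.mp hkK
  have hε' : Ideal.Quotient.mk L x * Ideal.Quotient.mk L x = Ideal.Quotient.mk L x := hε
  change _ ∈ L
  rw [← Ideal.Quotient.eq_zero_iff_mem, map_mul, map_sub, map_one, ← hc]
  linear_combination (-c) * hε'

/-- Lifting of a rank one idempotent in a finite algebra along a henselian pair. -/
lemma exists_idempotent_of_henselianRing (π : Ideal R) [HenselianRing R π] [Module.Finite R B]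
    (σ : B →ₐ[R] R ⧸ π) {b : B} (hb : σ b = 1)
    (hbk : ∀ k, σ k = 0 → b * k ∈ π.map (algebraMap R B)) :
    ∃ e : B, IsIdempotentElem e ∧ σ e = 1 ∧ ∀ x, ∃ c : R, x * e = c • e := by
  classical
  have hjac : π ≤ Ideal.jacobson ⊥ := HenselianRing.jac
  have hfgtop : (⊤ : Submodule R B).FG := Module.Finite.fg_top
  have hmap (x : B) : x ∈ π.map (algebraMap R B) ↔ x ∈ π • (⊤ : Submodule R B) := by
    rw [Ideal.smul_top_eq_map]; rfl
  obtain ⟨n, s, hs⟩ := Module.Finite.exists_fin (R := R) (M := B)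
  choose o ho using fun i ↦ Ideal.Quotient.mk_surjective (σ (s i))
  let k (i : Fin n) : B := s i - algebraMap R B (o i)
  have hk (i) : σ (k i) = 0 := by
    rw [map_sub, AlgHom.commutes, ← ho]
    exact sub_self _
  have hdecomp (x : B) : ∃ c : R, x - algebraMap R B c ∈ Submodule.span R (Set.range k) := by
    obtain ⟨c, rfl⟩ := (Submodule.mem_span_range_iff_exists_fun R).mp
      (hs ▸ Submodule.mem_top : x ∈ Submodule.span R (Set.range s))
    refine ⟨∑ i, c i * o i, (Submodule.mem_span_range_iff_exists_fun R).mpr ⟨c, ?_⟩⟩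
    simp [k, mul_sub, Algebra.smul_def]
  have hspan0 (x : B) (hx : x ∈ Submodule.span R (Set.range k)) : σ x = 0 := by
    obtain ⟨c, rfl⟩ := (Submodule.mem_span_range_iff_exists_fun R).mp hx
    simp [hk]
  have hker (x : B) (hx : σ x = 0) :
      x ∈ Submodule.span R (Set.range k) ⊔ π • (⊤ : Submodule R B) := by
    obtain ⟨c, hc⟩ := hdecomp x
    have h1 := hspan0 _ hc
    rw [map_sub, hx, AlgHom.commutes, zero_sub, neg_eq_zero] at h1
    have h2 : c ∈ π := Ideal.Quotient.eq_zero_iff_mem.mp h1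
    rw [← sub_add_cancel x (algebraMap R B c)]
    refine Submodule.add_mem_sup hc ?_
    rw [← hmap]
    exact Ideal.mem_map_of_mem _ h2
  -- The generators are adapted to multiplication by `b`: modulo `π` it fixes `b` and kills each `k
  -- i`. Hence `A` reduces to the diagonal matrix with entries `1, 0, …, 0`, and its characteristic
  -- polynomial to `(X - 1) * X ^ n`, with simple root `1`.
  let v : Option (Fin n) → B := fun i ↦ i.elim b k
  have hv : Submodule.span R (Set.range v) = ⊤ := by
    refine top_le_iff.mp (Submodule.le_of_le_smul_of_le_jacobson_bot hfgtop hjac fun x _ ↦ ?_)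
    have hkv : Submodule.span R (Set.range k) ≤ Submodule.span R (Set.range v) :=
      Submodule.span_mono (by rintro _ ⟨i, rfl⟩; exact ⟨some i, rfl⟩)
    have hker' (x : B) (hx : σ x = 0) := sup_le_sup_right hkv (π • (⊤ : Submodule R B)) (hker x hx)
    have hbv : b ∈ Submodule.span R (Set.range v) := Submodule.subset_span ⟨none, rfl⟩
    obtain ⟨c, hc⟩ := Ideal.Quotient.mk_surjective (σ x)
    rw [← sub_add_cancel x (c • b)]
    refine add_mem (hker' _ ?_) (Submodule.mem_sup_left (Submodule.smul_mem _ _ hbv))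
    rw [map_sub, map_smul, hb, ← hc, Algebra.smul_def, _root_.mul_one]
    exact sub_self _
  let d : Option (Fin n) → R := fun i ↦ i.elim 1 fun _ ↦ 0
  have hcol (j) : b * v j - d j • v j ∈ LinearMap.range (Ideal.finsuppTotal _ B π v) := by
    rw [Ideal.range_finsuppTotal, hv, ← hmap]
    cases j with
    | none =>
      have : b * b - (1 : R) • b = b * (b - 1) := by rw [one_smul]; ring
      change b * b - (1 : R) • b ∈ _
      rw [this]
      exact hbk _ (by rw [map_sub, hb, map_one, sub_self])
    | some i =>
      change b * k i - (0 : R) • k i ∈ _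
      rw [zero_smul, sub_zero]
      exact hbk _ (hk i)
  choose p hp using hcol
  let A : Matrix (Option (Fin n)) (Option (Fin n)) R :=
    Matrix.diagonal d + Matrix.of fun i j ↦ (p j i : R)
  have hA : A.Represents v (LinearMap.mulLeft R b) := by
    rw [Matrix.represents_iff']
    intro j
    have h1 := hp j
    rw [Ideal.finsuppTotal_apply_eq_of_fintype] at h1
    simp only [A, Matrix.add_apply, add_smul, Finset.sum_add_distrib, Matrix.of_apply,
      LinearMap.mulLeft_apply]
    rw [h1]
    simp [Matrix.diagonal_apply]
  let f := A.charpoly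
  have hfb : aeval b f = 0 := by
    have h1 := Matrix.isRepresentation.eq_toEnd_of_represents R v hv ⟨A, _, hA⟩ hA
    have h2 : aeval (LinearMap.mulLeft R b) f = 0 := by
      rw [← h1, Polynomial.aeval_algHom_apply,
        ← map_zero (Matrix.isRepresentation.toEnd R v hv)]
      congr 1
      ext1
      rw [Polynomial.aeval_subalgebra_coe, Matrix.aeval_self_charpoly, Subalgebra.coe_zero]
    have h3 : aeval (Algebra.lmul R B b) f = 0 := h2
    rw [Polynomial.aeval_algHom_apply] at h3
    simpa using congr($h3 1)
  have hfmap : f.map (Ideal.Quotient.mk π) = (X - C 1) * X ^ n := by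
    rw [← Matrix.charpoly_map]
    have : A.map (Ideal.Quotient.mk π) = Matrix.diagonal fun i ↦ Ideal.Quotient.mk π (d i) := by
      ext i j
      have h1 : Ideal.Quotient.mk π (p j i) = 0 := Ideal.Quotient.eq_zero_iff_mem.mpr (p j i).2
      by_cases hij : i = j
      · subst hij; simp [A, h1]
      · simp [A, h1, hij]
    rw [this, Matrix.charpoly_diagonal, Fintype.prod_option]
    simp [d]
  have hfev : f.eval 1 ∈ π := by
    rw [← Ideal.Quotient.eq_zero_iff_mem, ← Polynomial.eval_map_apply, hfmap]
    simp
  have hfder : IsUnit (Ideal.Quotient.mk π (f.derivative.eval 1)) := by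
    rw [← Polynomial.eval_map_apply, ← Polynomial.derivative_map, hfmap]
    simp
  obtain ⟨r, hr, hr1⟩ := HenselianRing.is_henselian (I := π) f A.charpoly_monic 1 hfev hfder
  obtain ⟨q, hq⟩ := Polynomial.dvd_iff_isRoot.mpr hr
  have hr1' : Ideal.Quotient.mk π r = 1 := by
    rw [← map_one (Ideal.Quotient.mk π)]; exact Ideal.Quotient.eq.mpr hr1
  have hqmap : q.map (Ideal.Quotient.mk π) = X ^ n := by
    have h1 : (X - C (1 : R ⧸ π)) * q.map (Ideal.Quotient.mk π) = (X - C 1) * X ^ n := by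
      rw [← hfmap, hq, Polynomial.map_mul, Polynomial.map_sub, map_X, map_C, hr1']
    exact (Polynomial.monic_X_sub_C (1 : R ⧸ π)).isRegular.left h1
  have hloc := isLocalHom_of_le_jacobson_bot π hjac
  have hqr : IsUnit (q.eval r) := by
    refine IsUnit.of_map (Ideal.Quotient.mk π) _ ?_
    rw [← Polynomial.eval_map_apply, hqmap, hr1']
    simp
  obtain ⟨w, hw⟩ := hqr
  have hru : IsUnit r := IsUnit.of_map (Ideal.Quotient.mk π) _ (hr1' ▸ isUnit_one)
  obtain ⟨r', rfl⟩ := hru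
  have hbq : (b - algebraMap R B r') * aeval b q = 0 := by
    rw [← hfb, hq]; simp
  obtain ⟨z, hz⟩ : b - algebraMap R B r' ∣ aeval b q - algebraMap R B w := by
    have := Polynomial.sub_dvd_eval_sub b (algebraMap R B r') (q.map (algebraMap R B))
    rwa [Polynomial.eval_map_algebraMap, Polynomial.eval_map_algebraMap, aeval_algebraMap_apply,
      coe_aeval_eq_eval, ← hw] at this
  -- With `f = (X - r') * q`, this is `q(b) / q(r')`, the projector onto the eigenvalue `r'` of
  -- multiplication by `b`.
  let e : B := (↑w⁻¹ : R) • aeval b q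
  have hwq : (w : R) • e = aeval b q := by rw [smul_smul, Units.mul_inv, one_smul]
  have hqq : aeval b q * aeval b q = (w : R) • aeval b q := by
    rw [Algebra.smul_def]
    linear_combination aeval b q * hz + z * hbq
  have he : IsIdempotentElem e := by
    change e * e = e
    rw [smul_mul_smul_comm, hqq, smul_smul, _root_.mul_assoc, Units.inv_mul, _root_.mul_one]
  have hσe : σ e = 1 := by
    have h1 : σ (aeval b q) = 1 := by
      rw [← Polynomial.aeval_algHom_apply, hb, aeval_def, ← Polynomial.eval_map]
      change (q.map (Ideal.Quotient.mk π)).eval 1 = 1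
      rw [hqmap]
      simp
    have h2 : algebraMap R (R ⧸ π) w = 1 := by
      change Ideal.Quotient.mk π w = 1
      rw [hw, ← Polynomial.eval_map_apply, hqmap, hr1']
      simp
    rw [← hwq, map_smul, Algebra.smul_def, h2, _root_.one_mul] at h1
    exact h1
  have hbe : b * e = (r' : R) • e := by
    rw [Algebra.smul_def, ← sub_eq_zero, ← sub_mul, mul_smul_comm, hbq, smul_zero]
  let N : Submodule R B := LinearMap.range (LinearMap.mulRight R e)
  -- Nakayama for `B e`: if the scalar `c` lifts `σ x`, then `(x - c) * e` equals `r'⁻¹ * b * (x -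
  -- c) * e`, and `b * (x - c)` lies in `π B`.
  have hN : N ≤ Submodule.span R {e} := by
    refine Submodule.le_of_le_smul_of_le_jacobson_bot
      (Module.Finite.iff_fg.mp (Module.Finite.range _)) hjac ?_
    rintro _ ⟨x, rfl⟩
    obtain ⟨c, hc⟩ := Ideal.Quotient.mk_surjective (σ x)
    have hk0 : σ (x - algebraMap R B c) = 0 := by
      rw [map_sub, AlgHom.commutes, ← hc]
      exact sub_self _
    have h1 : x * e = c • e + (↑r'⁻¹ : R) • ((b * (x - algebraMap R B c)) * e) := by
      have : (b * (x - algebraMap R B c)) * e = (r' : R) • ((x - algebraMap R B c) * e) := by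
        rw [← mul_smul_comm, ← hbe]; ring
      rw [this, smul_smul (↑r'⁻¹ : R), Units.inv_mul, one_smul, sub_mul, Algebra.smul_def]
      ring
    rw [LinearMap.mulRight_apply, h1]
    refine Submodule.add_mem_sup (Submodule.smul_mem _ _ (Submodule.mem_span_singleton_self e))
      (Submodule.smul_mem _ _ ?_)
    have h2 := (hmap _).mp (hbk _ hk0)
    have h3 := Submodule.mem_map_of_mem (f := LinearMap.mulRight R e) h2
    rwa [Submodule.map_smul'', Submodule.map_top] at h3
  refine ⟨e, he, hσe, fun x ↦ ?_⟩
  obtain ⟨c, hc⟩ := Submodule.mem_span_singleton.mp (hN ⟨x, rfl⟩)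
  exact ⟨c, hc.symm⟩

/-- Sections of étale algebras lift along henselian pairs. -/
theorem exists_algHom_lift_of_etale (π : Ideal R) [HenselianRing R π] [Algebra.Etale R C]
    (σ : C →ₐ[R] R ⧸ π) : ∃ τ : C →ₐ[R] R, ∀ x, Ideal.Quotient.mk π (τ x) = σ x := by
  have hsurj : Function.Surjective (algebraMap R (R ⧸ π)) := Ideal.Quotient.mk_surjective
  obtain ⟨D, _, g, hg, hgx⟩ := exists_finite_subalgebra_forall_pow_mul_mem σ hsurj
  let κ : D →ₐ[R] R ⧸ π := σ.comp D.val
  have hκ : RingHom.ker κ ≤ RingHom.ker κ ^ 2 ⊔ π.map (algebraMap R D) := by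
    set L := RingHom.ker κ ^ 2 ⊔ π.map (algebraMap R D) with hL
    -- The kernel of `σ` is idempotent modulo `π` in the étale algebra `C`. Multiplying by powers of
    -- `g` brings this relation down to `D`, and the discrepancy `(1 - g ^ m) * x` lies in the
    -- square of the kernel.
    let N : Ideal C :=
      { carrier := {x | ∃ m, ∃ y ∈ L, (y : C) = g ^ m * x}
        zero_mem' := ⟨0, 0, zero_mem _, by simp⟩
        add_mem' := by
          rintro x y ⟨a, u, hu, hu'⟩ ⟨c, v, hv, hv'⟩
          refine ⟨a + c, g ^ c * u + g ^ a * v,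
            add_mem (Ideal.mul_mem_left _ _ hu) (Ideal.mul_mem_left _ _ hv), ?_⟩
          push_cast
          rw [hu', hv']
          ring
        smul_mem' := by
          rintro c x ⟨a, u, hu, hu'⟩
          obtain ⟨m, hm⟩ := hgx c
          refine ⟨m + a, ⟨_, hm⟩ * u, Ideal.mul_mem_left _ _ hu, ?_⟩
          push_cast
          rw [hu', smul_eq_mul]
          ring }
    have hN : RingHom.ker σ ^ 2 ⊔ π.map (algebraMap R C) ≤ N := by
      refine sup_le ?_ ?_
      · rw [sq, Ideal.mul_le]
        intro u hu v hv
        obtain ⟨a, ha⟩ := hgx u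
        obtain ⟨c, hc⟩ := hgx v
        rw [RingHom.mem_ker] at hu hv
        refine ⟨a + c, ⟨_, ha⟩ * ⟨_, hc⟩, Ideal.mem_sup_left ?_, by push_cast; ring⟩
        rw [sq]
        exact Ideal.mul_mem_mul (by simp [RingHom.mem_ker, κ, hu])
          (by simp [RingHom.mem_ker, κ, hv])
      · rw [Ideal.map_le_iff_le_comap]
        exact fun r hr ↦ ⟨0, algebraMap R D r, Ideal.mem_sup_right (Ideal.mem_map_of_mem _ hr),
          by simp⟩
    intro x hx
    have h0 := ker_le_sq_sup_of_formallyUnramified σ hsurj (x := x.1) hx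
    obtain ⟨m, y, hm, h⟩ := hN (by convert h0 using 3; exact Ideal.mk_ker.symm)
    obtain rfl : y = g ^ m * x := Subtype.ext (by rw [h]; push_cast; ring)
    have hg1 : 1 - g ^ m ∈ RingHom.ker κ := by
      rw [RingHom.mem_ker, map_sub, map_one, map_pow, show κ g = 1 from hg, one_pow, sub_self]
    have : x = (1 - g ^ m) * x + g ^ m * x := by ring
    rw [this]
    exact add_mem (Ideal.mem_sup_left (by rw [sq]; exact Ideal.mul_mem_mul hg1 hx)) hm
  obtain ⟨b, hb, hbk⟩ := exists_mul_mem_map_of_ker_le_sq_sup π κ hκ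
  obtain ⟨e', he', hσe', hx'⟩ := exists_idempotent_of_henselianRing π κ hb hbk
  obtain ⟨e, he, hσe, hxD⟩ : ∃ e : C, IsIdempotentElem e ∧ σ e = 1 ∧
      ∀ x ∈ D, ∃ c : R, x * e = c • e :=
    ⟨e', congr_arg Subtype.val he', hσe', fun x hx ↦ by
      obtain ⟨c, hc⟩ := hx' ⟨x, hx⟩
      exact ⟨c, congr_arg Subtype.val hc⟩⟩
  have hloc := isLocalHom_of_le_jacobson_bot π HenselianRing.jac
  have hunit {r : R} (hr : Ideal.Quotient.mk π r = 1) : IsUnit r :=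
    IsUnit.of_map (Ideal.Quotient.mk π) r (hr ▸ isUnit_one)
  have hσ {c : R} {x : C} (h : x * e = c • e) : Ideal.Quotient.mk π c = σ x := by
    have := congr(σ $h)
    rw [map_mul, map_smul, hσe, _root_.mul_one, Algebra.smul_def, _root_.mul_one] at this
    exact this.symm
  -- On `e` the element `g` acts as a unit of `R`, so the powers of `g` needed to enter `D` can be
  -- divided out.
  have hxC (x : C) : ∃ c : R, x * e = c • e := by
    obtain ⟨c, hc⟩ := hxD g g.2
    obtain ⟨u, rfl⟩ := hunit ((hσ hc).trans hg)
    obtain ⟨m, hm⟩ := hgx x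
    obtain ⟨d, hd⟩ := hxD _ hm
    have hpow : ∀ m, (g ^ m * e : C) = (u ^ m : R) • e := fun m ↦ by
      induction m with
      | zero => simp
      | succ m ih =>
        rw [pow_succ, _root_.mul_assoc, hc, mul_smul_comm, ih, smul_smul, pow_succ, mul_comm]
    refine ⟨(↑u⁻¹ : R) ^ m * d, ?_⟩
    have h1 : (u ^ m : R) • (x * e) = d • e := by
      rw [← hd, ← mul_smul_comm, ← hpow]; ring
    rw [mul_smul, ← h1, smul_smul, ← mul_pow, Units.inv_mul, one_pow, one_smul]
  -- Flatness of `C` turns `o • e = 0` into `e = ∑ a_j y_j` with `o * a_j = 0`. Multiplying by `e`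
  -- gives `e = (∑ a_j c_j) • e`; the coefficient is `1` modulo `π`, hence a unit, and `o` kills it.
  -- So `R e` is free and the coefficients define `τ`.
  have hann {o : R} (ho : o • e = 0) : o = 0 := by
    obtain ⟨k, a, y, h1, h2⟩ := Module.Flat.isTrivialRelation_of_sum_smul_eq_zero
      (f := fun _ : Unit ↦ o) (x := fun _ ↦ e) (by simpa using ho)
    choose c hc using hxC
    have h3 : 1 * e = (∑ j, a () j * c (y j)) • e := by
      have h1' : e = ∑ j, a () j • y j := h1 ()
      conv_lhs => rw [_root_.one_mul, ← he.eq, h1', Finset.sum_mul, ← h1']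
      rw [Finset.sum_smul]
      refine Finset.sum_congr rfl fun j _ ↦ ?_
      rw [smul_mul_assoc, hc, smul_smul]
    have h4 := hunit ((hσ h3).trans (map_one σ))
    refine (h4.mul_left_eq_zero).mp ?_
    rw [Finset.mul_sum]
    exact Finset.sum_eq_zero fun j _ ↦ by
      have := h2 j
      simp only [Finset.univ_unique, Finset.sum_singleton] at this
      rw [← _root_.mul_assoc, this, zero_mul]
  have huniq {c d : R} (h : c • e = d • e) : c = d := by
    rw [← sub_eq_zero] at h ⊢
    exact hann (by rw [sub_smul, h])
  choose τ hτ using hxC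
  refine ⟨{ toFun := τ, map_one' := ?_, map_mul' := ?_, map_zero' := ?_, map_add' := ?_,
            commutes' := ?_ }, fun x ↦ hσ (hτ x)⟩
  · exact huniq (by rw [← hτ, _root_.one_mul, one_smul])
  · intro x y
    refine huniq ?_
    rw [← hτ, _root_.mul_assoc, hτ y, mul_smul_comm, hτ x, smul_smul, mul_comm]
  · exact huniq (by rw [← hτ, zero_mul, zero_smul])
  · intro x y
    exact huniq (by rw [← hτ, add_mul, hτ, hτ, add_smul])
  · intro r
    exact huniq (by rw [← hτ, Algebra.smul_def]; rfl)

end EtaleLift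

/-! ### From étale to smooth algebras. -/

section SmoothLift

open MvPolynomial

variable {R : Type*} [CommRing R]

/-- The first order Taylor expansion of a polynomial. -/
lemma MvPolynomial.aeval_add_sub_mem_sq {A κ : Type*} [CommRing A] [Algebra R A] [Fintype κ]
    {𝔞 : Ideal A} (x h : κ → A) (hh : ∀ i, h i ∈ 𝔞) (p : MvPolynomial κ R) :
    aeval (x + h) p - aeval x p - ∑ i, h i * aeval x (pderiv i p) ∈ 𝔞 ^ 2 := by
  classical
  have hmem (p : MvPolynomial κ R) : ∑ i, h i * aeval x (pderiv i p) ∈ 𝔞 :=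
    Ideal.sum_mem _ fun i _ ↦ Ideal.mul_mem_right _ _ (hh i)
  induction p using MvPolynomial.induction_on with
  | C a => simp
  | add p q hp hq =>
    convert add_mem hp hq using 1
    simp only [map_add, mul_add, Finset.sum_add_distrib]
    ring
  | mul_X p j hp =>
    have e : ∑ i, h i * aeval x (pderiv i (p * X j)) =
        (∑ i, h i * aeval x (pderiv i p)) * x j + h j * aeval x p := by
      simp only [pderiv_mul, map_add, map_mul, mul_add, Finset.sum_add_distrib, aeval_X,
        pderiv_X, Finset.sum_mul]
      congr 1
      · exact Finset.sum_congr rfl fun i _ ↦ by ring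
      · rw [Finset.sum_eq_single j]
        · simp
        · intro i _ hij
          simp [Pi.single_eq_of_ne' hij]
        · simp
    have h1 := Ideal.mul_mem_right (x j + h j) _ hp
    have h2 : (∑ i, h i * aeval x (pderiv i p)) * h j ∈ 𝔞 ^ 2 := by
      rw [sq]; exact Ideal.mul_mem_mul (hmem p) (hh j)
    convert add_mem h1 h2 using 1
    rw [e]
    simp only [map_mul, aeval_X, Pi.add_apply]
    ring

lemma MvPolynomial.pderiv_aeval {κ τ : Type*} [Fintype κ] (y : κ → MvPolynomial τ R)
    (p : MvPolynomial κ R) (l : τ) :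
    pderiv l (aeval y p) = ∑ i, aeval y (pderiv i p) * pderiv l (y i) := by
  classical
  induction p using MvPolynomial.induction_on with
  | C a => simp [algebraMap_eq]
  | add p q hp hq => simp only [map_add, hp, hq, add_mul, Finset.sum_add_distrib]
  | mul_X p j hp =>
    simp only [map_mul, aeval_X, pderiv_mul, hp, map_add, add_mul, Finset.sum_add_distrib,
      Finset.sum_mul, pderiv_X]
    congr 1
    · exact Finset.sum_congr rfl fun i _ ↦ by ring
    · rw [Finset.sum_eq_single j]
      · simp
      · intro i _ hij
        simp [Pi.single_eq_of_ne' hij]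
      · simp

/-- The Hensel lemma for a system of polynomials over a henselian pair. -/
theorem HenselianRing.exists_eval_eq_zero (π : Ideal R) [HenselianRing R π] {m : ℕ}
    (F : Fin m → MvPolynomial (Fin m) R) (hF : ∀ k, eval 0 (F k) ∈ π)
    (hJ : ∀ i k, eval 0 (pderiv i (F k)) = if i = k then 1 else 0) :
    ∃ t : Fin m → R, (∀ i, t i ∈ π) ∧ ∀ k, eval t (F k) = 0 := by
  let P := Algebra.PreSubmersivePresentation.naive (v := F) id Function.injective_id
  let E₁ := MvPolynomial (Fin m) R ⧸ Ideal.span (Set.range F)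
  -- Inverting the Jacobian determinant makes the square system étale; at the approximate solution
  -- `0` this determinant is `1`.
  let E := Localization.Away P.jacobian
  let Q := Algebra.PreSubmersivePresentation.localizationAway E P.jacobian
  have : Finite (Unit ⊕ Fin m) := inferInstance
  let S : Algebra.SubmersivePresentation R E (Unit ⊕ Fin m) (Unit ⊕ Fin m) :=
    { Q.comp P with
      jacobian_isUnit := by
        rw [Algebra.PreSubmersivePresentation.comp_jacobian_eq_jacobian_smul_jacobian,
          Algebra.PreSubmersivePresentation.localizationAway_jacobian, Algebra.smul_def]
        have := IsLocalization.Away.algebraMap_isUnit (S := E) P.jacobian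
        exact this.mul this }
  have : Algebra.IsStandardSmoothOfRelativeDimension 0 R E :=
    ⟨_, _, _, inferInstance, S, by simp [Algebra.Presentation.dimension]⟩
  let σ₁ : E₁ →ₐ[R] R ⧸ π := Ideal.Quotient.liftₐ _
    ((Ideal.Quotient.mkₐ R π).comp (aeval (0 : Fin m → R))) fun a ha ↦ by
      rw [← RingHom.mem_ker]
      refine Ideal.span_le.mpr ?_ ha
      rintro _ ⟨k, rfl⟩
      exact Ideal.Quotient.eq_zero_iff_mem.mpr (hF k)
  have hσ₁ (p : MvPolynomial (Fin m) R) :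
    σ₁ (Ideal.Quotient.mk _ p) = Ideal.Quotient.mk π (eval 0 p) := rfl
  have hjac : IsUnit (σ₁ P.jacobian) := by
    rw [Algebra.PreSubmersivePresentation.jacobian_eq_jacobiMatrix_det]
    change IsUnit (σ₁ (Ideal.Quotient.mk _ P.jacobiMatrix.det))
    rw [hσ₁, RingHom.map_det]
    have : (eval 0).mapMatrix P.jacobiMatrix = 1 := by
      ext i k
      rw [RingHom.mapMatrix_apply, Matrix.map_apply,
        Algebra.PreSubmersivePresentation.jacobiMatrix_naive, id, hJ, Matrix.one_apply]
    rw [this, Matrix.det_one, map_one]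
    exact isUnit_one
  let σ : E →ₐ[R] R ⧸ π := IsLocalization.liftAlgHom (M := Submonoid.powers P.jacobian)
    (f := σ₁) (by
      rintro ⟨_, n, rfl⟩
      rw [map_pow]
      exact hjac.pow n)
  obtain ⟨τ, hτ⟩ := exists_algHom_lift_of_etale π σ
  let ψ : MvPolynomial (Fin m) R →ₐ[R] R :=
    (τ.comp (IsScalarTower.toAlgHom R E₁ E)).comp (Ideal.Quotient.mkₐ R _)
  have hψ (p) : ψ p = τ (algebraMap E₁ E (Ideal.Quotient.mk _ p)) := rfl
  have hψe (p) : ψ p = eval (fun i ↦ ψ (X i)) p := by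
    conv_lhs => rw [aeval_unique ψ]
    rfl
  refine ⟨fun i ↦ ψ (X i), fun i ↦ ?_, fun k ↦ ?_⟩
  · beta_reduce
    rw [← Ideal.Quotient.eq_zero_iff_mem, hψ, hτ]
    have : σ (algebraMap E₁ E (Ideal.Quotient.mk _ (X i))) = σ₁ (Ideal.Quotient.mk _ (X i)) :=
      IsLocalization.lift_eq _ _
    rw [this, hσ₁]
    simp
  · rw [← hψe, hψ, Ideal.Quotient.eq_zero_iff_mem.mpr (Ideal.subset_span (Set.mem_range_self k)),
      map_zero, map_zero]

/-- A smooth algebra has, up to terms of second order, a projector onto its relations which factors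
through the Jacobian matrix. -/
lemma exists_matrix_of_formallySmooth {m n : ℕ} (f : Fin m → MvPolynomial (Fin n) R)
    [Algebra.FormallySmooth R (MvPolynomial (Fin n) R ⧸ Ideal.span (Set.range f))] :
    ∃ S : Matrix (Fin n) (Fin m) (MvPolynomial (Fin n) R),
      letI N : Matrix (Fin m) (Fin m) (MvPolynomial (Fin n) R) :=
        1 - Matrix.of (fun k i ↦ pderiv i (f k)) * S
      (∀ k, ∑ j, N k j * f j ∈ Ideal.span (Set.range f) ^ 2) ∧
        ∀ k j, (N * N - N) k j ∈ Ideal.span (Set.range f) := by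
  let J := Ideal.span (Set.range f)
  have hfJ (k) : f k ∈ J := Ideal.subset_span ⟨k, rfl⟩
  let q : MvPolynomial (Fin n) R ⧸ J ^ 2 →ₐ[R] MvPolynomial (Fin n) R ⧸ J :=
    Ideal.Quotient.factorₐ R (Ideal.pow_le_self two_ne_zero)
  have hq : Function.Surjective q :=
    Ideal.Quotient.factor_surjective (Ideal.pow_le_self two_ne_zero)
  have hqker : IsNilpotent
      (RingHom.ker (q : MvPolynomial (Fin n) R ⧸ J ^ 2 →+* MvPolynomial (Fin n) R ⧸ J)) := by
    refine ⟨2, ?_⟩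
    have : RingHom.ker (q : MvPolynomial (Fin n) R ⧸ J ^ 2 →+* MvPolynomial (Fin n) R ⧸ J) =
        J.map (Ideal.Quotient.mk (J ^ 2)) :=
      Ideal.Quotient.factor_ker (Ideal.pow_le_self two_ne_zero)
    rw [this, ← Ideal.map_pow, Ideal.map_quotient_self]
    rfl
  -- The splitting of `P ⧸ J ^ 2 → P ⧸ J`, for the polynomial ring `P`, moves the variables to `u`
  -- with `f(u) ∈ J ^ 2`; the matrix `S` expresses `X - u` through the relations `f`.
  let s := Algebra.FormallySmooth.liftOfSurjective (AlgHom.id R (MvPolynomial (Fin n) R ⧸ J)) q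
    hq hqker
  have hs (x) : q (s x) = x := Algebra.FormallySmooth.liftOfSurjective_apply _ _ _ _ x
  choose u hu using fun i ↦ Ideal.Quotient.mk_surjective (s (Ideal.Quotient.mk J (X i)))
  have hsu (p : MvPolynomial (Fin n) R) :
      s (Ideal.Quotient.mk J p) = Ideal.Quotient.mk (J ^ 2) (aeval u p) := by
    have : s.comp (Ideal.Quotient.mkₐ R J) = (Ideal.Quotient.mkₐ R (J ^ 2)).comp (aeval u) := by
      ext i
      simp [hu]
    exact congr($this p)
  have huX (i) : X i - u i ∈ J := by
    rw [← Ideal.Quotient.eq, ← hs (Ideal.Quotient.mk J (X i)), ← hu]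
    rfl
  have hc (i) : ∃ c : Fin m → MvPolynomial (Fin n) R, ∑ j, c j * f j = X i - u i :=
    (Ideal.mem_span_range_iff_exists_fun).mp (huX i)
  choose S hS using hc
  let S : Matrix (Fin n) (Fin m) (MvPolynomial (Fin n) R) := Matrix.of S
  have hS (i) : ∑ j, S i j * f j = X i - u i := hS i
  let D : Matrix (Fin m) (Fin n) (MvPolynomial (Fin n) R) := Matrix.of fun k i ↦ pderiv i (f k)
  let N : Matrix (Fin m) (Fin m) (MvPolynomial (Fin n) R) := 1 - D * S
  -- Taylor expansion: modulo `J ^ 2`, `f(u)` is `f - D S f = N f`.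
  have hNf (k) : ∑ j, N k j * f j ∈ J ^ 2 := by
    have h1 : aeval u (f k) ∈ J ^ 2 := by
      rw [← Ideal.Quotient.eq_zero_iff_mem, ← hsu, Ideal.Quotient.eq_zero_iff_mem.mpr (hfJ k),
        map_zero]
    have h2 := aeval_add_sub_mem_sq (𝔞 := J) X (fun i ↦ u i - X i)
      (fun i ↦ by rw [← neg_sub]; exact neg_mem (huX i)) (f k)
    have h3 : (X + fun i ↦ u i - X i : Fin n → MvPolynomial (Fin n) R) = u := by ext1 i; simp
    rw [h3] at h2
    have h4 : ∑ j, N k j * f j = f k - ∑ i, (X i - u i) * pderiv i (f k) := by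
      have hSf : S.mulVec f = fun i ↦ X i - u i := funext hS
      have h5 : N.mulVec f = f - D.mulVec fun i ↦ X i - u i := by
        rw [Matrix.sub_mulVec, Matrix.one_mulVec, ← Matrix.mulVec_mulVec, hSf]
      refine (congr_fun h5 k).trans (congr_arg (f k - ·) ?_)
      change ∑ i, pderiv i (f k) * (X i - u i) = _
      exact Finset.sum_congr rfl fun i _ ↦ mul_comm _ _
    have h5 := sub_mem h1 h2
    convert h5 using 1
    rw [h4]
    simp only [aeval_X_left, AlgHom.id_apply]
    have : ∑ i, (u i - X i) * pderiv i (f k) = - ∑ i, (X i - u i) * pderiv i (f k) := by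
      rw [← Finset.sum_neg_distrib]
      exact Finset.sum_congr rfl fun i _ ↦ by ring
    rw [this]
    ring
  -- Differentiating `N f ∈ J ^ 2` leaves `N D` modulo `J`. With `N = 1 - D S` this gives `N * N - N
  -- = -N D S ∈ J`.
  have hND (k i) : (N * D) k i ∈ J := by
    have hder : ∀ p ∈ J ^ 2, pderiv i p ∈ J := by
      intro p hp
      rw [sq] at hp
      induction hp using Submodule.mul_induction_on' with
      | mem_mul_mem a ha b hb =>
        rw [pderiv_mul]
        exact add_mem (Ideal.mul_mem_left _ _ hb) (Ideal.mul_mem_right _ _ ha)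
      | add a _ b _ ha hb => rw [map_add]; exact add_mem ha hb
    have h1 := hder _ (hNf k)
    simp only [map_sum, pderiv_mul, Finset.sum_add_distrib] at h1
    exact (Ideal.add_mem_iff_right _
      (Ideal.sum_mem _ fun j _ ↦ Ideal.mul_mem_left _ _ (hfJ j))).mp h1
  refine ⟨S, hNf, fun k j ↦ ?_⟩
  have h1 : N * N - N = - (N * D * S) := by
    rw [Matrix.mul_assoc]
    nth_rw 2 [show N = 1 - D * S from rfl]
    rw [Matrix.mul_sub, Matrix.mul_one, sub_sub_cancel_left]
  change (N * N - N) k j ∈ J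
  rw [h1, Matrix.neg_apply, Matrix.mul_apply]
  exact neg_mem (Ideal.sum_mem _ fun i _ ↦ Ideal.mul_mem_right _ _ (hND k i))

/-- Sections of smooth algebras lift along henselian pairs. -/
theorem exists_algHom_lift_of_smooth {A : Type*} [CommRing A] [Algebra R A] (π : Ideal R)
    [HenselianRing R π] [Algebra.Smooth R A]
    (σ : A →ₐ[R] R ⧸ π) : ∃ τ : A →ₐ[R] R, ∀ x, Ideal.Quotient.mk π (τ x) = σ x := by
  obtain ⟨n, φ, hφ, hker⟩ := Algebra.FinitePresentation.out (R := R) (A := A)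
  obtain ⟨m, f, hf⟩ := Submodule.fg_iff_exists_fin_generating_family.mp hker
  let J := Ideal.span (Set.range f)
  have hJ : J = RingHom.ker φ := hf
  have hfφ (k) : φ (f k) = 0 := by
    rw [← RingHom.mem_ker, ← hJ]
    exact Ideal.subset_span ⟨k, rfl⟩
  have : Algebra.FormallySmooth R (MvPolynomial (Fin n) R ⧸ Ideal.span (Set.range f)) :=
    .of_equiv ((Ideal.quotientEquivAlgOfEq R hJ).trans
      (Ideal.quotientKerAlgEquivOfSurjective hφ)).symm
  obtain ⟨S, hNf, hNN⟩ := exists_matrix_of_formallySmooth f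
  set N : Matrix (Fin m) (Fin m) (MvPolynomial (Fin n) R) :=
    1 - Matrix.of (fun k i ↦ pderiv i (f k)) * S with hN
  choose a ha using fun i ↦ Ideal.Quotient.mk_surjective (σ (φ (X i)))
  have hσa (p) : Ideal.Quotient.mk π (eval a p) = σ (φ p) := by
    have : (Ideal.Quotient.mkₐ R π).comp (aeval a) = σ.comp φ := by
      ext i
      simp [ha]
    exact congr($this p)
  let y (i : Fin n) : MvPolynomial (Fin m) R := C (a i) + ∑ j, C (eval a (S i j)) * X j
  have hy0 (p) : eval 0 (aeval y p) = eval a p := by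
    have : (aeval (0 : Fin m → R)).comp (aeval y) = aeval a := by
      ext i
      simp [y]
    exact congr($this p)
  -- The point sought is `a + S(a) t`. The extra term `N t` completes the Jacobian `D S` at `t = 0`
  -- to `D S + N = 1`.
  let F (k : Fin m) : MvPolynomial (Fin m) R := aeval y (f k) + ∑ j, aeval y (N k j) * X j
  obtain ⟨t, ht, hFt⟩ := HenselianRing.exists_eval_eq_zero π F
    (fun k ↦ by
      rw [← Ideal.Quotient.eq_zero_iff_mem, map_add, hy0, map_add, hσa, hfφ]
      simp)
    (fun l k ↦ by
      have h1 (i) : pderiv l (y i) = C (eval a (S i l)) := by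
        simp [y, pderiv_X, Pi.single_apply]
      simp only [F, map_add, pderiv_aeval, h1, map_sum, pderiv_mul, map_mul, hy0, eval_C, eval_X,
        pderiv_X, Pi.zero_apply, mul_zero, zero_add, Pi.single_apply]
      simp [hN, Matrix.one_apply, Matrix.mul_apply, eq_comm])
  let x (i : Fin n) : R := eval t (y i)
  have hxy (p) : eval t (aeval y p) = eval x p := by
    have : (aeval t).comp (aeval y) = aeval x := by
      ext i
      simp [x]
    exact congr($this p)
  have hxa (p) : Ideal.Quotient.mk π (eval x p) = σ (φ p) := by
    have : (Ideal.Quotient.mkₐ R π).comp (aeval x) = σ.comp φ := by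
      ext i
      have h1 (j) : Ideal.Quotient.mk π (t j) = 0 := Ideal.Quotient.eq_zero_iff_mem.mpr (ht j)
      simp [x, y, ha, h1]
    exact congr($this p)
  let L : Ideal R := Ideal.span (Set.range fun k ↦ eval x (f k))
  have hL : J.map (eval x) = L := by
    rw [Ideal.map_span, ← Set.range_comp]
    rfl
  have hLπ : L ≤ π := by
    rw [Ideal.span_le]
    rintro _ ⟨k, rfl⟩
    refine Ideal.Quotient.eq_zero_iff_mem.mp ?_
    rw [hxa, hfφ, map_zero]
  have hft (k) : eval x (f k) = - ∑ j, eval x (N k j) * t j := by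
    have := hFt k
    simp only [F, map_add, map_sum, map_mul, eval_X, hxy] at this
    exact eq_neg_of_add_eq_zero_left this
  -- From `f = -N t` at `x` follows `f = N f + (N * N - N) t`. The first term lies in `L * L` and
  -- the second in `π * L`; as `L ≤ π`, Nakayama gives `L = 0`.
  have hL0 : L ≤ ⊥ := by
    refine Submodule.le_of_le_smul_of_le_jacobson_bot (I := π)
      (Submodule.fg_span (Set.finite_range _))
      HenselianRing.jac ?_
    rw [bot_sup_eq, smul_eq_mul]
    refine Ideal.span_le.mpr ?_
    rintro _ ⟨l, rfl⟩
    have h1 : ∑ k, eval x (N l k) * eval x (f k) ∈ L * L := by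
      rw [← hL, ← sq, ← Ideal.map_pow]
      simpa using Ideal.mem_map_of_mem (eval x) (hNf l)
    have h2 (j) : eval x ((N * N - N) l j) * t j ∈ π * L := by
      rw [mul_comm (eval x _), ← hL]
      exact Ideal.mul_mem_mul (ht j) (Ideal.mem_map_of_mem _ (hNN l j))
    have h3 : eval x (f l) = ∑ k, eval x (N l k) * eval x (f k) +
        ∑ j, eval x ((N * N - N) l j) * t j := by
      simp only [Matrix.sub_apply, map_sub, sub_mul, Finset.sum_sub_distrib]
      rw [hft l]
      simp only [hft, mul_neg, Finset.sum_neg_distrib, Matrix.mul_apply, map_sum, map_mul,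
        Finset.mul_sum, Finset.sum_mul]
      rw [Finset.sum_comm]
      simp only [_root_.mul_assoc]
      ring
    simp only [SetLike.mem_coe]
    rw [h3]
    exact add_mem (Ideal.mul_mono_left hLπ h1) (Ideal.sum_mem _ fun j _ ↦ h2 j)
  let τ : A →ₐ[R] R := AlgHom.liftOfSurjective φ hφ (aeval x) (by
    intro p hp
    have hp' : p ∈ J := hJ ▸ hp
    exact hL0 (hL ▸ Ideal.mem_map_of_mem (eval x) hp'))
  refine ⟨τ, fun c ↦ ?_⟩
  obtain ⟨p, rfl⟩ := hφ c
  rw [← hxa]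
  exact congr_arg _ (AlgHom.liftOfSurjective_apply φ hφ _ _ p)

end SmoothLift

/-! ### Invertible ideals. -/

section InvertibleIdeal

open scoped TensorProduct

variable {O : Type*} [CommRing O] {π : Ideal O} [Module.Invertible O π]

/-- The trace ideal of an invertible module is the unit ideal. -/
lemma Ideal.eq_top_of_forall_dual_mem_radical {N : Ideal O}
    (h : ∀ (φ : Module.Dual O π) (a : π), φ a ∈ N.radical) : N = ⊤ := by
  rw [← Ideal.radical_eq_top, Ideal.eq_top_iff_one]
  obtain ⟨t, ht⟩ := (Module.Invertible.bijective (R := O) (M := π)).2 1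
  rw [← ht]
  clear ht
  induction t using TensorProduct.induction_on with
  | zero => simp
  | tmul φ a => simpa using h φ a
  | add x y hx hy => rw [map_add]; exact add_mem hx hy

/-- An element killed by a power of each element of an invertible ideal is zero. -/
lemma Ideal.eq_zero_of_forall_pow_mul_eq_zero {r : O} (h : ∀ p ∈ π, ∃ n : ℕ, p ^ n * r = 0) :
    r = 0 := by
  suffices (⊤ : Ideal O) ≤ (Ideal.span {r}).annihilator by
    simpa [Submodule.mem_annihilator_span_singleton] using this (Submodule.mem_top (x := 1))
  refine (Ideal.eq_top_of_forall_dual_mem_radical (π := π) fun φ a ↦ ?_).ge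
  obtain ⟨n, hn⟩ := h a a.2
  refine ⟨n, Submodule.mem_annihilator_span_singleton _ _ |>.mpr ?_⟩
  -- If `a ^ (m + 1) * x = 0`, then `a ^ m * x` kills `a` as an element of `π`, so it kills `φ a`.
  -- This exchanges one factor `a` for `φ a`.
  have key (m : ℕ) (x : O) (hx : (a : O) ^ m * x = 0) : φ a ^ m * x = 0 := by
    induction m generalizing x with
    | zero => simpa using hx
    | succ m ih =>
      have h1 : (a : O) ^ m * (φ a * x) = 0 := by
        have h2 : ((a : O) ^ m * x) • a = 0 :=
          Subtype.ext (by
            rw [Submodule.coe_smul, smul_eq_mul, Submodule.coe_zero, ← hx]; ring)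
        have h3 := congr(φ $h2)
        rw [map_smul, map_zero, smul_eq_mul] at h3
        rw [← h3]; ring
      rw [pow_succ, _root_.mul_assoc]
      exact ih _ h1
  exact key n r hn

lemma Ideal.eq_zero_of_forall_mem_pow_mul_eq_zero {r : O} (n : ℕ) (h : ∀ p ∈ π ^ n, p * r = 0) :
    r = 0 :=
  Ideal.eq_zero_of_forall_pow_mul_eq_zero fun _ hp ↦ ⟨n, h _ (Ideal.pow_mem_pow hp n)⟩

/-- Powers of invertible ideals are invertible. -/
instance Ideal.invertible_pow (n : ℕ) : Module.Invertible O (π ^ n : Ideal O) := by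
  induction n with
  | zero =>
    rw [pow_zero, Ideal.one_eq_top]
    exact .congr Submodule.topEquiv.symm
  | succ n ih =>
    let f : TensorProduct O (π ^ n : Ideal O) π →ₗ[O] O :=
      TensorProduct.lift ((LinearMap.mul O O).domRestrict₁₂ (π ^ n : Ideal O) π)
    -- Flatness of `π` embeds `π ^ n ⊗ π` into `O ⊗ π`, hence into `O`.
    have hf : Function.Injective f := by
      have h1 : f = TensorProduct.lid O O ∘ₗ (LinearMap.lTensor O π.subtype) ∘ₗ
          (LinearMap.rTensor π (π ^ n : Ideal O).subtype) := by
        ext; rfl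
      rw [h1]
      exact (TensorProduct.lid O O).injective.comp
        ((Module.Flat.lTensor_preserves_injective_linearMap _ π.injective_subtype).comp
          (Module.Flat.rTensor_preserves_injective_linearMap _ (Submodule.injective_subtype _)))
    have hr : LinearMap.range f = (π ^ (n + 1) : Ideal O) := by
      refine le_antisymm ?_ ?_
      · rintro _ ⟨t, rfl⟩
        induction t using TensorProduct.induction_on with
        | zero => simp
        | tmul p q => rw [pow_succ]; exact Ideal.mul_mem_mul p.2 q.2
        | add x y hx hy => rw [map_add]; exact add_mem hx hy
      · rw [pow_succ]
        exact Ideal.mul_le.mpr fun _ hp _ hq ↦ ⟨⟨_, hp⟩ ⊗ₜ[O] ⟨_, hq⟩, rfl⟩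
    exact .congr ((LinearEquiv.ofInjective f hf).trans (LinearEquiv.ofEq _ _ hr))

/-- The linear endomorphisms of a power of an invertible ideal are the multiplications. -/
lemma Ideal.exists_forall_eq_mul (n : ℕ)
    (f : (π ^ n : Ideal O) →ₗ[O] (π ^ n : Ideal O)) : ∃ r, ∀ p, (f p : O) = p * r := by
  obtain ⟨r, hr⟩ := (Module.Invertible.toModuleEnd_bijective O (π ^ n : Ideal O)).2 f
  refine ⟨r, fun p ↦ ?_⟩
  rw [← hr]
  simp [mul_comm]

end InvertibleIdeal

namespace Dilatation

/-! ### Extending sections to affine blowup algebras. -/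

section AffineSections

variable {O B C : Type*} [CommRing O] [CommRing B] [CommRing C] {π : Ideal O}
  [Module.Invertible O π] {α : O →+* B} {β : B →+* O} {ρ : B →+* C}
  {I J : Ideal B} {hJI : J ≤ I}

/-- The structure map from `B` to an affine blowup algebra. -/
def affineBlowupStr (ρ : B →+* C) (I J : Ideal B) (hJI : J ≤ I) : B →+* affineBlowup ρ I J hJI :=
  ρ.codRestrict _ (map_mem_affineBlowup ρ I J hJI)

/-- A section over `O` lifts in at most one way to the affine blowup algebra along an
invertible ideal of `O`. -/
lemma affineBlowup_hom_ext (hJ : J = π.map α) (hβα : ∀ a, β (α a) = a)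
    (ξ ζ : affineBlowup ρ I J hJI →+* O)
    (hξ : ξ.comp (affineBlowupStr ρ I J hJI) = β) (hζ : ζ.comp (affineBlowupStr ρ I J hJI) = β) :
    ξ = ζ := by
  ext s
  obtain ⟨n, hn⟩ := s.2
  rw [← sub_eq_zero]
  refine Ideal.eq_zero_of_forall_mem_pow_mul_eq_zero (π := π) n fun p hp ↦ ?_
  obtain ⟨x, -, ex⟩ := hn (α p) (by rw [hJ, ← Ideal.map_pow]; exact Ideal.mem_map_of_mem _ hp)
  have ex' : affineBlowupStr ρ I J hJI (α p) * s = affineBlowupStr ρ I J hJI x := Subtype.ext ex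
  have h1 := congr(ξ $ex')
  have h2 := congr(ζ $ex')
  have hξ' (b) : ξ (affineBlowupStr ρ I J hJI b) = β b := congr($hξ b)
  have hζ' (b) : ζ (affineBlowupStr ρ I J hJI b) = β b := congr($hζ b)
  rw [map_mul, hξ', hξ', hβα] at h1
  rw [map_mul, hζ', hζ', hβα] at h2
  rw [mul_sub, h1, h2, sub_self]

/-- A section over `O` which maps `I` into `π` lifts to the affine blowup algebra. -/
lemma exists_affineBlowup_hom (hJ : J = π.map α) (hβα : ∀ a, β (α a) = a)
    (hker : ∀ x, ρ x = 0 → β x = 0) (hI : ∀ x ∈ I, β x ∈ π) :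
    ∃ ξ : affineBlowup ρ I J hJI →+* O, ξ.comp (affineBlowupStr ρ I J hJI) = β := by
  have hIn (n : ℕ) {x : B} (hx : x ∈ I ^ n) : β x ∈ π ^ n := by
    have h1 : I.map β ≤ π := Ideal.map_le_iff_le_comap.mpr hI
    have h2 := Ideal.mem_map_of_mem β hx
    rw [Ideal.map_pow] at h2
    exact Ideal.pow_right_mono h1 n h2
  have heq {x y : B} (h : ρ x = ρ y) : β x = β y := by
    rw [← sub_eq_zero, ← map_sub]
    exact hker _ (by rw [map_sub, h, sub_self])
  -- The graph of the extension: `r` is the value at `s` if it satisfies the images of all relations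
  -- that clear denominators of `s` by `π ^ n`.
  let Q (s : C) (r : O) (n : ℕ) : Prop := ∀ q ∈ π ^ n, ∃ x, ρ (α q) * s = ρ x ∧ q * r = β x
  have hmono {s r n} (h : Q s r n) {m} (hm : n ≤ m) : Q s r m := fun q hq ↦
    h q (Ideal.pow_le_pow_right hm hq)
  have hex (s : affineBlowup ρ I J hJI) : ∃ r n, Q s r n := by
    obtain ⟨s, n, hn⟩ := s
    have hn' (p : (π ^ n : Ideal O)) : ∃ x ∈ I ^ n, ρ (α p) * s = ρ x :=
      hn (α p) (by rw [hJ, ← Ideal.map_pow]; exact Ideal.mem_map_of_mem _ p.2)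
    choose x hx ex using hn'
    -- Well defined because `β x` depends only on `ρ x`; the values stay in `π ^ n` because `β` maps
    -- `I ^ n` there.
    let f : (π ^ n : Ideal O) →ₗ[O] (π ^ n : Ideal O) :=
      { toFun p := ⟨β (x p), hIn n (hx p)⟩
        map_add' p q := Subtype.ext <| by
          change β _ = β _ + β _
          rw [← map_add]
          refine heq ?_
          rw [map_add, ← ex, ← ex, ← ex, ← add_mul, ← map_add, ← map_add]
          rfl
        map_smul' c p := Subtype.ext <| by
          change β _ = c * β _
          nth_rw 2 [← hβα c]
          rw [← map_mul]
          refine heq ?_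
          rw [map_mul, ← ex, ← ex, ← _root_.mul_assoc, ← map_mul, ← map_mul]
          rfl }
    obtain ⟨r, hr⟩ := Ideal.exists_forall_eq_mul n f
    exact ⟨r, n, fun q hq ↦ ⟨x ⟨q, hq⟩, ex ⟨q, hq⟩, (hr ⟨q, hq⟩).symm⟩⟩
  have huniq {s r r' n n'} (h : Q s r n) (h' : Q s r' n') : r = r' := by
    rw [← sub_eq_zero]
    refine Ideal.eq_zero_of_forall_mem_pow_mul_eq_zero (π := π) (max n n') fun q hq ↦ ?_
    obtain ⟨x, hx, hx'⟩ := hmono h (le_max_left n n') q hq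
    obtain ⟨y, hy, hy'⟩ := hmono h' (le_max_right n n') q hq
    rw [mul_sub, hx', hy', heq (hx.symm.trans hy), sub_self]
  have hstr (b : B) : Q (ρ b) (β b) 0 := fun q _ ↦
    ⟨α q * b, by rw [map_mul], by rw [map_mul, hβα]⟩
  have hadd {s r s' r' n n'} (h : Q s r n) (h' : Q s' r' n') : Q (s + s') (r + r') (max n n') := by
    intro q hq
    obtain ⟨x, hx, hx'⟩ := hmono h (le_max_left n n') q hq
    obtain ⟨y, hy, hy'⟩ := hmono h' (le_max_right n n') q hq
    exact ⟨x + y, by rw [mul_add, hx, hy, map_add], by rw [mul_add, hx', hy', map_add]⟩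
  have hmul {s r s' r' n n'} (h : Q s r n) (h' : Q s' r' n') : Q (s * s') (r * r') (n + n') := by
    intro q hq
    rw [pow_add] at hq
    induction hq using Submodule.mul_induction_on' with
    | mem_mul_mem a ha b hb =>
      obtain ⟨x, hx, hx'⟩ := h a ha
      obtain ⟨y, hy, hy'⟩ := h' b hb
      refine ⟨x * y, ?_, ?_⟩
      · rw [map_mul, map_mul, map_mul, ← hx, ← hy]; ring
      · rw [map_mul, ← hx', ← hy']; ring
    | add a _ b _ iha ihb =>
      obtain ⟨x, hx, hx'⟩ := iha
      obtain ⟨y, hy, hy'⟩ := ihb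
      exact ⟨x + y, by rw [map_add, map_add, map_add, add_mul, hx, hy],
        by rw [map_add, add_mul, hx', hy']⟩
  choose ξ n hξ using hex
  refine ⟨{ toFun := ξ, map_one' := ?_, map_mul' := ?_, map_zero' := ?_, map_add' := ?_ }, ?_⟩
  · have := hstr 1
    rw [map_one, map_one] at this
    exact huniq (hξ 1) this
  · exact fun s t ↦ huniq (hξ (s * t)) (hmul (hξ s) (hξ t))
  · have := hstr 0
    rw [map_zero, map_zero] at this
    exact huniq (hξ 0) this
  · exact fun s t ↦ huniq (hξ (s + t)) (hadd (hξ s) (hξ t))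
  · ext b
    exact huniq (hξ _) (hstr b)

end AffineSections

/-! ### Points of the dilatation over an affine open. -/

section Dilatation

open Limits AlgebraicGeometry.Scheme AlgebraicGeometry.Scheme.AffineZariskiSite Opposite

variable {X : Scheme.{u}} (I J : X.IdealSheafData) (hJI : J ≤ I)
  (hJ : ∀ U : X.affineOpens, (J.ideal U).FG)

/-- The open immersion of the spectrum of the affine blowup algebra over an affine open. -/
noncomputable def specBlowupToDilatation {U : X.Opens} (hU : IsAffineOpen U) :
    Spec (.of (blowupAlgebra I J hJI hU)) ⟶ dilatation I J hJI hJ :=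
  (relativeGluingData (blowupMap_coequifibered I hJI hJ)).cover.f ⟨U, hU⟩

lemma isPullback_specBlowupToDilatation {U : X.Opens} (hU : IsAffineOpen U) :
    IsPullback (Spec.map (CommRingCat.ofHom (blowupStr I J hJI hU)))
      (specBlowupToDilatation I J hJI hJ hU) hU.fromSpec (dilatationMap I J hJI hJ) := by
  have h := (relativeGluingData (blowupMap_coequifibered I hJI hJ)).isPullback_natTrans_ι_toBase
    ⟨U, hU⟩
  refine h.of_iso (Iso.refl _) hU.isoSpec (Iso.refl _) (Iso.refl _) ?_ ?_ ?_ ?_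
  · change (Spec.map (CommRingCat.ofHom (blowupStr I J hJI hU)) ≫ hU.isoSpec.inv) ≫
      hU.isoSpec.hom = 𝟙 _ ≫ _
    simp
  · exact (Category.comp_id _).trans (Category.id_comp _).symm
  · exact (Category.comp_id _).trans (IsAffineOpen.isoSpec_hom_fromSpec hU).symm
  · exact (Category.comp_id _).trans (Category.id_comp _).symm

lemma exists_comp_dilatationMap_eq_iff {U : X.Opens} (hU : IsAffineOpen U) {R : Type u}
    [CommRing R] (β : Γ(X, U) →+* R) :
    (∃ x : Spec (.of R) ⟶ dilatation I J hJI hJ,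
      x ≫ dilatationMap I J hJI hJ = Spec.map (CommRingCat.ofHom β) ≫ hU.fromSpec) ↔
    ∃ ξ : blowupAlgebra I J hJI hU →+* R, ξ.comp (blowupStr I J hJI hU) = β := by
  have h := isPullback_specBlowupToDilatation I J hJI hJ hU
  constructor
  · rintro ⟨x, hx⟩
    obtain ⟨ξ, hξ⟩ := Spec.map_surjective (h.lift _ x hx.symm)
    refine ⟨ξ.hom, ?_⟩
    have h1 := h.lift_fst _ x hx.symm
    rw [← hξ, ← Spec.map_comp] at h1
    exact congr(($(Spec.map_injective h1)).hom)
  · rintro ⟨ξ, rfl⟩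
    refine ⟨Spec.map (CommRingCat.ofHom ξ) ≫ specBlowupToDilatation I J hJI hJ hU, ?_⟩
    rw [CommRingCat.ofHom_comp, Spec.map_comp, Category.assoc, Category.assoc, h.w]

lemma eq_of_comp_dilatationMap_eq {U : X.Opens} (hU : IsAffineOpen U) {R : Type u}
    [CommRing R] (β : Γ(X, U) →+* R)
    (hβ : ∀ ξ ζ : blowupAlgebra I J hJI hU →+* R, ξ.comp (blowupStr I J hJI hU) = β →
      ζ.comp (blowupStr I J hJI hU) = β → ξ = ζ)
    {x y : Spec (.of R) ⟶ dilatation I J hJI hJ}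
    (hx : x ≫ dilatationMap I J hJI hJ = Spec.map (CommRingCat.ofHom β) ≫ hU.fromSpec)
    (hy : y ≫ dilatationMap I J hJI hJ = Spec.map (CommRingCat.ofHom β) ≫ hU.fromSpec) :
    x = y := by
  have h := isPullback_specBlowupToDilatation I J hJI hJ hU
  have key {z : Spec (.of R) ⟶ dilatation I J hJI hJ}
      (hz : z ≫ dilatationMap I J hJI hJ = Spec.map (CommRingCat.ofHom β) ≫ hU.fromSpec) :
      ∃ ξ : blowupAlgebra I J hJI hU →+* R, ξ.comp (blowupStr I J hJI hU) = β ∧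
        z = Spec.map (CommRingCat.ofHom ξ) ≫ specBlowupToDilatation I J hJI hJ hU := by
    obtain ⟨ξ, hξ⟩ := Spec.map_surjective (h.lift _ z hz.symm)
    refine ⟨ξ.hom, ?_, ?_⟩
    · have h1 := h.lift_fst _ z hz.symm
      rw [← hξ, ← Spec.map_comp] at h1
      exact congr(($(Spec.map_injective h1)).hom)
    · rw [CommRingCat.ofHom_hom, hξ]
      exact (h.lift_snd _ z hz.symm).symm
  obtain ⟨ξ, hξ, rfl⟩ := key hx
  obtain ⟨ζ, hζ, rfl⟩ := key hy
  rw [hβ ξ ζ hξ hζ]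
end Dilatation

/-! ### The ideal sheaves on affine opens of the group scheme. -/

section AffineOpen

open AlgebraicGeometry.Scheme Opposite

variable {O : Type u} [CommRing O] (π : Ideal O) (G : Over (Spec (.of O)))

/-- The structure map from `O` to the functions on an open subset of `G`. -/
noncomputable def scalars (U : G.left.Opens) : O →+* Γ(G.left, U) :=
  (resRingHom le_top).comp (globalScalars G)

lemma resRingHom_scalars {U V : G.left.Opens} (h : U ≤ V) (a : O) :
    resRingHom h (scalars G V a) = scalars G U a := by
  change (resRingHom h).comp (resRingHom le_top) _ = _
  rw [resRingHom_comp]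
  rfl

lemma fromSpec_comp_hom {U : G.left.Opens} (hU : IsAffineOpen U) :
    hU.fromSpec ≫ G.hom = Spec.map (CommRingCat.ofHom (scalars G U)) := by
  have h1 : G.hom = G.left.toSpecΓ ≫ Spec.map G.hom.appTop ≫
      Spec.map (ΓSpecIso (.of O)).inv := by
    rw [← Scheme.toSpecΓ_naturality_assoc, ← SpecMap_ΓSpecIso_hom, ← Spec.map_comp,
      Iso.inv_hom_id, Spec.map_id, Category.comp_id]
  rw [h1, IsAffineOpen.fromSpec_toSpecΓ_assoc, ← Spec.map_comp, ← Spec.map_comp]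
  rfl

lemma smooth_scalars [Smooth G.hom] {U : G.left.Opens} (hU : IsAffineOpen U) :
    (scalars G U).Smooth := by
  have h1 := Smooth.smooth_appLE G.hom (isAffineOpen_top _) hU le_top
  have h2 : scalars G U = (G.hom.appLE ⊤ U le_top).hom.comp (ΓSpecIso (.of O)).inv.hom := rfl
  rw [h2]
  exact (RingHom.Smooth.of_bijective
    (ConcreteCategory.bijective_of_isIso (ΓSpecIso (.of O)).inv)).comp h1

lemma fibreIdeal_ideal {U : G.left.Opens} (hU : IsAffineOpen U) :
    (fibreIdeal π G).ideal ⟨U, hU⟩ = π.map (scalars G U) := by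
  rw [fibreIdeal, IdealSheafData.ofIdealTop_ideal, Ideal.map_map]
  rfl

lemma basicOpen_scalars_le {U : G.left.Opens} (hU : IsAffineOpen U) {a : O} (ha : a ∈ π) :
    G.left.basicOpen (scalars G U a) ≤ U ⊓ complement (fibreIdeal π G) := by
  refine le_inf (G.left.basicOpen_le _) fun x hx h ↦ ?_
  have h' := (IdealSheafData.mem_support_iff_of_mem (U := ⟨U, hU⟩)
    (G.left.basicOpen_le _ hx)).mp h
  refine (G.left.mem_zeroLocus_iff _ _).mp h' (scalars G U a) ?_ hx
  rw [fibreIdeal_ideal]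
  exact Ideal.mem_map_of_mem _ ha

/-- For `a ∈ π` the function `x` vanishes on `D(a)`, so some `a ^ n` kills `x` and hence `β x`;
invertibility of `π` then forces `β x = 0`. This is the compatibility that `exists_affineBlowup_hom`
asks of `ρ` and `β`. -/
lemma section_eq_zero_of_resRingHom_eq_zero [Module.Invertible O π] {U : G.left.Opens}
    (hU : IsAffineOpen U)
    {β : Γ(G.left, U) →+* O} (hβ : ∀ a, β (scalars G U a) = a) {x : Γ(G.left, U)}
    (hx : resRingHom (U := U ⊓ complement (fibreIdeal π G)) inf_le_left x = 0) : β x = 0 := by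
  refine Ideal.eq_zero_of_forall_pow_mul_eq_zero (π := π) fun a ha ↦ ?_
  have h1 : resRingHom (G.left.basicOpen_le (scalars G U a)) x = 0 := by
    rw [← resRingHom_comp (basicOpen_scalars_le π G hU ha) inf_le_left, RingHom.comp_apply, hx,
      map_zero]
  have := hU.isLocalization_basicOpen (scalars G U a)
  obtain ⟨n, hn⟩ := IsLocalization.Away.exists_of_eq
    (S := Γ(G.left, G.left.basicOpen (scalars G U a)))
    (scalars G U a) (a := x) (b := 0) (by
      rw [map_zero]; exact h1)
  refine ⟨n, ?_⟩
  have h2 := congr(β $hn)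
  rwa [map_mul, map_pow, hβ, mul_zero, map_zero] at h2

/-- Linearity gives `φ a * p = φ p * a` for `p ∈ π`, so `a` generates `π` where `φ a` is invertible.
Such loci cover, which reduces questions about `π` to the principal case. -/
lemma fibreIdeal_ideal_basicOpen {U : G.left.Opens} (hU : IsAffineOpen U)
    (φ : Module.Dual O π) (a : π) :
    (fibreIdeal π G).ideal ⟨_, hU.basicOpen (scalars G U (φ a))⟩ =
      Ideal.span {scalars G (G.left.basicOpen (scalars G U (φ a))) a} := by
  rw [fibreIdeal_ideal]
  refine le_antisymm (Ideal.map_le_iff_le_comap.mpr fun p hp ↦ ?_)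
    ((Ideal.span_singleton_le_iff_mem _).mpr (Ideal.mem_map_of_mem _ a.2))
  have hunit : IsUnit (scalars G (G.left.basicOpen (scalars G U (φ a))) (φ a)) := by
    rw [← resRingHom_scalars G (G.left.basicOpen_le _)]
    exact RingedSpace.isUnit_res_basicOpen _ _
  have hcomm : φ a * p = φ ⟨p, hp⟩ * a := by
    rw [mul_comm, mul_comm (φ ⟨p, hp⟩), ← smul_eq_mul, ← smul_eq_mul, ← map_smul,
      ← map_smul φ (a : O)]
    exact congr_arg φ (Subtype.ext (mul_comm _ _))
  rw [Ideal.mem_comap, ← Ideal.unit_mul_mem_iff_mem _ hunit, ← map_mul, hcomm, map_mul]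
  exact Ideal.mul_mem_left _ _ (Ideal.mem_span_singleton_self _)

lemma isUnit_resRingHom_of_ideal_eq_span {X : Scheme.{u}} {J : X.IdealSheafData} {U : X.Opens}
    (hU : IsAffineOpen U) {g : Γ(X, U)} (h : J.ideal ⟨U, hU⟩ = Ideal.span {g}) :
    IsUnit (resRingHom (U := U ⊓ complement J) inf_le_left g) := by
  have hle : U ⊓ complement J ≤ X.basicOpen g := by
    intro x hx
    by_contra hxg
    refine hx.2 ((IdealSheafData.mem_support_iff_of_mem (U := ⟨U, hU⟩) hx.1).mpr ?_)
    rw [h, Ideal.span, zeroLocus_span]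
    exact (X.mem_zeroLocus_iff _ _).mpr (by simpa using hxg)
  rw [← resRingHom_comp hle (X.basicOpen_le g), RingHom.comp_apply]
  exact (RingedSpace.isUnit_res_basicOpen _ _).map _

/-- A section over `O` which lifts to the dilatation maps the ideal of the centre into `π`. -/
lemma section_mem_of_blowupAlgebra_hom [Module.Invertible O π] (I : G.left.IdealSheafData)
    (hJI : fibreIdeal π G ≤ I) {U : G.left.Opens} (hU : IsAffineOpen U)
    {β : Γ(G.left, U) →+* O} (hβ : ∀ a, β (scalars G U a) = a)
    {ξ : blowupAlgebra I (fibreIdeal π G) hJI hU →+* O}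
    (hξ : ξ.comp (blowupStr I (fibreIdeal π G) hJI hU) = β) {b : Γ(G.left, U)}
    (hb : b ∈ I.ideal ⟨U, hU⟩) : β b ∈ π := by
  have hξ' (x) : ξ (blowupStr I (fibreIdeal π G) hJI hU x) = β x := congr($hξ x)
  -- The colon ideal of `π` by `β b` is shown to be the unit ideal, locally on the loci where some
  -- `φ a` is invertible.
  suffices Submodule.comap (LinearMap.toSpanSingleton O O (β b)) π = ⊤ by
    have h1 : (1 : O) ∈ Submodule.comap (LinearMap.toSpanSingleton O O (β b)) π := by
      rw [this]; trivial
    simpa using h1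
  refine Ideal.eq_top_of_forall_dual_mem_radical (π := π) fun φ a ↦ ?_
  set f := scalars G U (φ a) with hf
  have hspan := fibreIdeal_ideal_basicOpen π G hU φ a
  rw [← hf] at hspan
  have hU' := hU.basicOpen f
  obtain ⟨w, hw⟩ := (isUnit_resRingHom_of_ideal_eq_span hU' hspan).exists_right_inv
  let ρ := resRingHom (G.left.basicOpen_le f)
  -- The fraction `b / a`, with `w` the inverse of `a`. Clearing powers of `f` turns `a * s' = b`
  -- into a relation over `U`, to which `ξ` applies.
  let s' : blowupAlgebra I (fibreIdeal π G) hJI hU' :=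
    ⟨resRingHom inf_le_left (ρ b) * w, 1, fun g hg ↦ by
      rw [pow_one, hspan, Ideal.mem_span_singleton'] at hg
      obtain ⟨d, rfl⟩ := hg
      refine ⟨d * ρ b, Ideal.mul_mem_left _ _ ?_, ?_⟩
      · rw [pow_one, ← I.map_ideal (U := ⟨_, hU'⟩) (V := ⟨U, hU⟩) (G.left.basicOpen_le f)]
        exact Ideal.mem_map_of_mem _ hb
      · rw [map_mul, map_mul]
        linear_combination (resRingHom inf_le_left d * resRingHom inf_le_left (ρ b)) * hw⟩
  let str := blowupStr I (fibreIdeal π G) hJI hU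
  let res := blowupRes I (fibreIdeal π G) hJI hU' hU (G.left.basicOpen_le f)
  let := res.toAlgebra
  have hloc : IsLocalization.Away (str f) (blowupAlgebra I (fibreIdeal π G) hJI hU') :=
    isLocalization_blowup I hJI (fibreIdeal_fg π G (fg_of_invertible π)) hU f hU' rfl
  have hstr (x) : res (str x) = blowupStr I (fibreIdeal π G) hJI hU' (ρ x) :=
    congr($(blowupRes_comp_blowupStr I (fibreIdeal π G) hJI hU' hU (G.left.basicOpen_le f)) x)
  have hs' : res (str (scalars G U a)) * s' = res (str b) := by
    rw [hstr, hstr, show ρ (scalars G U a) = _ from resRingHom_scalars G _ _]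
    refine Subtype.ext ?_
    change resRingHom inf_le_left _ * (resRingHom inf_le_left (ρ b) * w) =
      resRingHom inf_le_left (ρ b)
    linear_combination (resRingHom inf_le_left (ρ b)) * hw
  obtain ⟨n, t, ht⟩ := IsLocalization.Away.surj (str f) s'
  change s' * res (str f) ^ n = res t at ht
  obtain ⟨m, hm⟩ := IsLocalization.Away.exists_of_eq
    (S := blowupAlgebra I (fibreIdeal π G) hJI hU') (str f)
    (a := str (scalars G U a) * t) (b := str b * str f ^ n) (by
      change res _ = res _
      rw [map_mul, map_mul, map_pow, ← ht, ← hs']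
      ring)
  have hm' := congr(ξ $hm)
  simp only [map_mul, map_pow, str, hξ', hf, hβ] at hm'
  refine ⟨m + n, ?_⟩
  have : (LinearMap.toSpanSingleton O O (β b)) (φ a ^ (m + n)) = φ a ^ m * ξ t * a := by
    rw [LinearMap.toSpanSingleton_apply, smul_eq_mul]
    linear_combination -hm'
  rw [Submodule.mem_comap, this]
  exact Ideal.mul_mem_left _ _ a.2

end AffineOpen

/-! ### Points of the group scheme and their reductions. -/

section Points

open AlgebraicGeometry.Scheme Opposite

/-- A morphism from an affine scheme factors through an affine open subscheme if its source is
local or its target is affine. -/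
lemma exists_eq_specMap_comp_fromSpec {X : Scheme.{u}} {R : Type u} [CommRing R]
    (h : IsLocalRing R ∨ IsAffine X) (f : Spec (.of R) ⟶ X) :
    ∃ (U : X.Opens) (hU : IsAffineOpen U) (β : Γ(X, U) →+* R),
      f = Spec.map (CommRingCat.ofHom β) ≫ hU.fromSpec := by
  obtain ⟨U, hU, hf⟩ : ∃ U : X.Opens, IsAffineOpen U ∧ f ⁻¹ᵁ U = ⊤ := by
    obtain h | h := h
    · obtain ⟨_, ⟨U, hU, rfl⟩, hx, -⟩ := X.isBasis_affineOpens.exists_subset_of_mem_open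
        (Set.mem_univ (f (IsLocalRing.closedPoint R))) isOpen_univ
      exact ⟨U, hU, (IsLocalRing.closedPoint_mem_iff (R := R) (f ⁻¹ᵁ U)).mp hx⟩
    · exact ⟨⊤, isAffineOpen_top X, rfl⟩
  have hrange : Set.range f ⊆ Set.range hU.fromSpec := by
    rw [hU.range_fromSpec]
    rintro _ ⟨x, rfl⟩
    have : x ∈ f ⁻¹ᵁ U := by rw [hf]; trivial
    exact this
  obtain ⟨β, hβ⟩ := Spec.map_surjective (IsOpenImmersion.lift hU.fromSpec f hrange)
  refine ⟨U, hU, β.hom, ?_⟩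
  rw [CommRingCat.ofHom_hom, hβ, IsOpenImmersion.lift_fac]

lemma fromSpec_appLE {X : Scheme.{u}} {U : X.Opens} (hU : IsAffineOpen U) :
    hU.fromSpec.appLE U ⊤ hU.fromSpec_preimage_self.ge = (ΓSpecIso Γ(X, U)).inv := by
  rw [Hom.appLE, hU.fromSpec_app_self, Category.assoc, ← Functor.map_comp]
  exact (congr_arg _ ((Spec Γ(X, U)).presheaf.map_id _)).trans (Category.comp_id _)

lemma specMap_comp_fromSpec_appLE {X : Scheme.{u}} {U : X.Opens} (hU : IsAffineOpen U)
    {R : Type u} [CommRing R] (τ : Γ(X, U) →+* R)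
    (h : ⊤ ≤ (Spec.map (CommRingCat.ofHom τ) ≫ hU.fromSpec) ⁻¹ᵁ U) :
    (Spec.map (CommRingCat.ofHom τ) ≫ hU.fromSpec).appLE U ⊤ h =
      CommRingCat.ofHom τ ≫ (ΓSpecIso (.of R)).inv := by
  have h1 : CommRingCat.ofHom τ ≫ (ΓSpecIso (.of R)).inv =
      (ΓSpecIso Γ(X, U)).inv ≫ (Spec.map (CommRingCat.ofHom τ)).appTop :=
    ΓSpecIso_inv_naturality _
  rw [h1, ← fromSpec_appLE hU, Hom.appTop, Hom.app_eq_appLE]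
  exact (Hom.appLE_comp_appLE _ _ _ _ _ _ _).symm

/-- By adjunction, the containment can be tested after pulling `I` back to the affine open through
which the morphism factors. -/
lemma le_ker_specMap_comp_fromSpec {X : Scheme.{u}} (I : X.IdealSheafData) {U : X.Opens}
    (hU : IsAffineOpen U) {R : Type u} [CommRing R] (τ : Γ(X, U) →+* R)
    (hτ : ∀ b ∈ I.ideal ⟨U, hU⟩, τ b = 0) :
    I ≤ (Spec.map (CommRingCat.ofHom τ) ≫ hU.fromSpec).ker := by
  rw [Hom.ker_comp, IdealSheafData.le_map_iff_comap_le]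
  refine IdealSheafData.le_of_isAffine fun t ht ↦ ?_
  rw [IdealSheafData.ideal_comap_of_isOpenImmersion, Ideal.mem_comap] at ht
  rw [Hom.ker_apply, RingHom.mem_ker]
  have hUV : U ≤ hU.fromSpec ''ᵁ ⊤ := by
    rw [Hom.image_top_eq_opensRange, hU.opensRange_fromSpec]
  set t' := (hU.fromSpec.appIso ⊤).inv t with ht'
  have h1 : resRingHom hUV t' ∈ I.ideal ⟨U, hU⟩ := by
    rw [← I.map_ideal (U := ⟨U, hU⟩) (V := ⟨_, (isAffineOpen_top _).image_of_isOpenImmersion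
      hU.fromSpec⟩) hUV]
    exact Ideal.mem_map_of_mem _ ht
  have h2 : t = (ΓSpecIso Γ(X, U)).inv (resRingHom hUV t') := by
    have h3 := Hom.map_appLE hU.fromSpec hU.fromSpec_preimage_self.ge (homOfLE hUV).op
    rw [fromSpec_appLE] at h3
    have h4 := Hom.appIso_inv_appLE hU.fromSpec (U := ⊤) (V := ⊤)
      (Hom.preimage_image_eq hU.fromSpec ⊤).ge
    have h5 : t = (Spec Γ(X, U)).presheaf.map (homOfLE le_rfl).op t :=
      congr($((Spec Γ(X, U)).presheaf.map_id (op ⊤)) t).symm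
    exact h5.trans (congr($h4 t).symm.trans congr($h3 t').symm)
  have h6 := congr($(ΓSpecIso_inv_naturality (CommRingCat.ofHom τ)) (resRingHom hUV t'))
  rw [h2]
  refine h6.symm.trans ?_
  change (ΓSpecIso (.of R)).inv (τ _) = 0
  rw [hτ _ h1, map_zero]

variable {O : Type u} [CommRing O] {π : Ideal O} {G : Over (Spec (.of O))} {R : Type u} [CommRing R]
  {σ : O →+* R}

lemma comp_scalars_of_left_eq {z : Over.mk (Spec.map (CommRingCat.ofHom σ)) ⟶ G}
    {U : G.left.Opens} {hU : IsAffineOpen U} {β : Γ(G.left, U) →+* R}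
    (hz : z.left = Spec.map (CommRingCat.ofHom β) ≫ hU.fromSpec) : β.comp (scalars G U) = σ := by
  have h1 := Over.w z
  rw [hz, Category.assoc, fromSpec_comp_hom, ← Spec.map_comp] at h1
  exact congr(($(Spec.map_injective h1)).hom)

/-- Separatedness makes the unit section over `O ⧸ π` a closed immersion, so `z` factors through it
as soon as `z` kills its ideal. The factoring map is an endomorphism of `Spec (O ⧸ π)` over `Spec
O`, hence the identity because `Spec (O ⧸ π) → Spec O` is a monomorphism. -/
lemma eq_one_iff [IsSeparated G.hom] [GrpObj G]
    {z : quotScheme π ⟶ G} {U : G.left.Opens}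
    {hU : IsAffineOpen U} {τ : Γ(G.left, U) →+* O ⧸ π}
    (hz : z.left = Spec.map (CommRingCat.ofHom τ) ≫ hU.fromSpec) :
    z = 1 ↔ ∀ b ∈ (unitIdeal π G).ideal ⟨U, hU⟩, τ b = 0 := by
  constructor
  · intro h b hb
    have h1 : z.left.app U b = 0 := by
      subst h
      exact Hom.ideal_ker_le _ _ hb
    have h2 : ⊤ ≤ z.left ⁻¹ᵁ U := by
      rw [hz, Hom.comp_preimage, hU.fromSpec_preimage_self]
      rfl
    have h3 : z.left.appLE U ⊤ h2 b = 0 := by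
      rw [Hom.appLE, CommRingCat.comp_apply, h1, map_zero]
    have h4 : (ΓSpecIso (.of (O ⧸ π))).inv (τ b) = 0 := by
      rw [← h3]
      simp only [hz]
      rw [specMap_comp_fromSpec_appLE]
      rfl
    simpa using congr((ΓSpecIso (.of (O ⧸ π))).hom $h4)
  · intro h
    have h1 : (1 : quotScheme π ⟶ G).left.ker ≤ z.left.ker :=
      hz ▸ le_ker_specMap_comp_fromSpec _ hU τ h
    have : IsClosedImmersion ((1 : quotScheme π ⟶ G).left ≫ G.hom) := by
      rw [Over.w]
      exact IsClosedImmersion.spec_of_surjective _ Ideal.Quotient.mk_surjective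
    have := IsClosedImmersion.of_comp (1 : quotScheme π ⟶ G).left G.hom
    have h2 := IsClosedImmersion.lift_fac (1 : quotScheme π ⟶ G).left z.left h1
    have h3 := Over.w z
    rw [← h2, Category.assoc, Over.w] at h3
    have : IsClosedImmersion (quotScheme π).hom :=
      IsClosedImmersion.spec_of_surjective _ Ideal.Quotient.mk_surjective
    have h4 : IsClosedImmersion.lift (1 : quotScheme π ⟶ G).left z.left h1 = 𝟙 _ := by
      rw [← cancel_mono (quotScheme π).hom]
      exact h3.trans (Category.id_comp _).symm
    ext1
    rw [← h2, h4]
    exact Category.id_comp _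

lemma isLocalRing_quotient_of_henselian {O : Type*} [CommRing O] (π : Ideal O)
    [HenselianRing O π] [IsLocalRing O] : IsLocalRing (O ⧸ π) := by
  have : Nontrivial (O ⧸ π) := Ideal.Quotient.nontrivial_iff.mpr fun h ↦ by
    have h1 := HenselianRing.jac (I := π)
    rw [h, top_le_iff, Ideal.jacobson_eq_top_iff] at h1
    exact bot_ne_top h1
  exact .of_surjective' (Ideal.Quotient.mk π) Ideal.Quotient.mk_surjective

variable {O : Type u} [CommRing O] (π : Ideal O) (G : Over (Spec (.of O)))

lemma exists_eq_specMap_comp_fromSpec_of_baseScheme (hG : IsLocalRing O ∨ IsAffine G.left)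
    (z : baseScheme O ⟶ G) :
    ∃ (U : G.left.Opens) (hU : IsAffineOpen U) (β : Γ(G.left, U) →+* O),
      z.left = Spec.map (CommRingCat.ofHom β) ≫ hU.fromSpec ∧ ∀ a, β (scalars G U a) = a := by
  obtain ⟨U, hU, β, hz⟩ := exists_eq_specMap_comp_fromSpec hG z.left
  refine ⟨U, hU, β, hz, fun a ↦ ?_⟩
  have h1 := Over.w z
  rw [hz, Category.assoc, fromSpec_comp_hom, ← Spec.map_comp] at h1
  exact congr(($(Spec.map_injective (h1.trans (Spec.map_id _).symm))).hom a)

lemma quotMap_comp_left {z : baseScheme O ⟶ G} {U : G.left.Opens} {hU : IsAffineOpen U}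
    {β : Γ(G.left, U) →+* O} (hz : z.left = Spec.map (CommRingCat.ofHom β) ≫ hU.fromSpec) :
    (quotMap π ≫ z).left =
      Spec.map (CommRingCat.ofHom ((Ideal.Quotient.mk π).comp β)) ≫ hU.fromSpec := by
  rw [Over.comp_left, hz, CommRingCat.ofHom_comp, Spec.map_comp, Category.assoc]
  rfl

/-- Smooth schemes have enough points over a henselian pair. -/
lemma exists_quotMap_comp_eq [HenselianRing O π] [Smooth G.hom]
    (hG : IsLocalRing O ∨ IsAffine G.left) (w : quotScheme π ⟶ G) :
    ∃ z : baseScheme O ⟶ G, quotMap π ≫ z = w := by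
  have hG' : IsLocalRing (O ⧸ π) ∨ IsAffine G.left := by
    obtain h | h := hG
    · exact .inl (isLocalRing_quotient_of_henselian π)
    · exact .inr h
  obtain ⟨U, hU, τ, hw⟩ := exists_eq_specMap_comp_fromSpec hG' w.left
  have hτ := comp_scalars_of_left_eq hw
  let := (scalars G U).toAlgebra
  have : Algebra.Smooth O Γ(G.left, U) := smooth_scalars G hU
  obtain ⟨β, hβ⟩ := exists_algHom_lift_of_smooth π
    ({ τ with commutes' := fun a ↦ congr($hτ a) } : Γ(G.left, U) →ₐ[O] O ⧸ π)
  have hβ' : (Ideal.Quotient.mk π).comp β.toRingHom = τ := RingHom.ext hβ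
  refine ⟨Over.homMk (Spec.map (CommRingCat.ofHom β.toRingHom) ≫ hU.fromSpec) ?_, ?_⟩
  · rw [Category.assoc, fromSpec_comp_hom, ← Spec.map_comp, ← CommRingCat.ofHom_comp]
    rw [show β.toRingHom.comp (scalars G U) = RingHom.id O from RingHom.ext β.commutes]
    exact Spec.map_id _
  · ext1
    rw [quotMap_comp_left π G (hU := hU) (β := β.toRingHom) rfl, hβ', hw]

variable [Module.Invertible O π] [GrpObj G]

/-- Both sides say that `β` maps the ideal of the unit section into `π`: the left by the universal
property of the blowup algebra, the right by `eq_one_iff`. -/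
lemma exists_comp_neronBlowupMap_eq_iff [IsSeparated G.hom]
    (hG : IsLocalRing O ∨ IsAffine G.left) (z : baseScheme O ⟶ G) :
    (∃ x, x ≫ neronBlowupMap π G = z) ↔ quotMap π ≫ z = 1 := by
  obtain ⟨U, hU, β, hz, hβ⟩ := exists_eq_specMap_comp_fromSpec_of_baseScheme G hG z
  have h1 : (∃ x, x ≫ neronBlowupMap π G = z) ↔ ∃ x : Spec (.of O) ⟶ _,
      x ≫ dilatationMap (unitIdeal π G) (fibreIdeal π G) (fibreIdeal_le_unitIdeal π G)
        (fibreIdeal_fg π G (fg_of_invertible π)) =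
          Spec.map (CommRingCat.ofHom β) ≫ hU.fromSpec := by
    rw [← hz]
    constructor
    · rintro ⟨x, rfl⟩
      exact ⟨x.left, rfl⟩
    · rintro ⟨x, hx⟩
      refine ⟨Over.homMk x ?_, ?_⟩
      · change x ≫ _ ≫ G.hom = _
        exact (Category.assoc _ _ _).symm.trans ((congr_arg (· ≫ G.hom) hx).trans (Over.w z))
      · ext1
        exact hx
  rw [h1, exists_comp_dilatationMap_eq_iff, eq_one_iff (quotMap_comp_left π G hz)]
  simp only [RingHom.comp_apply, Ideal.Quotient.eq_zero_iff_mem]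
  exact ⟨fun ⟨ξ, hξ⟩ b hb ↦ section_mem_of_blowupAlgebra_hom π G _ _ hU hβ hξ hb, fun h ↦
    exists_affineBlowup_hom (fibreIdeal_ideal π G hU) hβ
      (fun x hx ↦ section_eq_zero_of_resRingHom_eq_zero π G hU hβ hx) h⟩

lemma comp_neronBlowupMap_injective (hG : IsLocalRing O ∨ IsAffine G.left) :
    Function.Injective fun x : baseScheme O ⟶ neronBlowup π G ↦ x ≫ neronBlowupMap π G := by
  intro x y hxy
  obtain ⟨U, hU, β, hz, hβ⟩ := exists_eq_specMap_comp_fromSpec_of_baseScheme G hG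
    (x ≫ neronBlowupMap π G)
  ext1
  refine eq_of_comp_dilatationMap_eq _ _ _ (fibreIdeal_fg π G (fg_of_invertible π)) hU β
    (fun ξ ζ hξ hζ ↦ affineBlowup_hom_ext (fibreIdeal_ideal π G hU) hβ ξ ζ hξ hζ) hz ?_
  rw [← hz]
  exact congr(($hxy).left).symm

end Points

end Dilatation

/-! ### The exact sequence. -/

theorem lemma4p2 {O : Type u} [CommRing O] (π : Ideal O) [Module.Invertible O π]
    [HenselianRing O π] (G : Over (Spec (.of O))) [GrpObj G] [Smooth G.hom] [IsSeparated G.hom]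
    (hG : IsLocalRing O ∨ IsAffine G.left) :
    ∃ (grp : Group (baseScheme O ⟶ neronBlowup π G))
      (φ : (baseScheme O ⟶ neronBlowup π G) →* (baseScheme O ⟶ G)),
      (∀ x, φ x = x ≫ neronBlowupMap π G) ∧
      (∀ grp' : Group (baseScheme O ⟶ neronBlowup π G),
        (∀ x y, grp'.mul x y ≫ neronBlowupMap π G =
          (x ≫ neronBlowupMap π G) * (y ≫ neronBlowupMap π G)) → grp' = grp) ∧
      Function.Injective φ ∧
      φ.range = (reduction π G).ker ∧
      Function.Surjective (reduction π G) := by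
  have hinj := comp_neronBlowupMap_injective π G hG
  have hker (z : baseScheme O ⟶ G) : (∃ x, x ≫ neronBlowupMap π G = z) ↔
      z ∈ (reduction π G).ker := exists_comp_neronBlowupMap_eq_iff π G hG z
  let f (x : baseScheme O ⟶ neronBlowup π G) : (reduction π G).ker :=
    ⟨x ≫ neronBlowupMap π G, (hker _).mp ⟨x, rfl⟩⟩
  have hf : Function.Bijective f := by
    refine ⟨fun x y h ↦ hinj congr(($h).1), fun z ↦ ?_⟩
    obtain ⟨x, hx⟩ := (hker z.1).mpr z.2
    exact ⟨x, Subtype.ext hx⟩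
  let e := Equiv.ofBijective f hf
  -- The structure is transported from the kernel of reduction, so that `φ` is a homomorphism by
  -- construction.
  let grp : Group (baseScheme O ⟶ neronBlowup π G) := e.group
  let φ : (baseScheme O ⟶ neronBlowup π G) →* (baseScheme O ⟶ G) :=
    (reduction π G).ker.subtype.comp (Equiv.mulEquiv e).toMonoidHom
  have hφ (x) : φ x = x ≫ neronBlowupMap π G := rfl
  have hmul (x y) : grp.mul x y ≫ neronBlowupMap π G =
      (x ≫ neronBlowupMap π G) * (y ≫ neronBlowupMap π G) := map_mul φ x y
  refine ⟨grp, φ, hφ, fun grp' h ↦ ?_, hinj, ?_, exists_quotMap_comp_eq π G hG⟩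
  · refine Group.ext ?_
    ext x y : 2
    exact hinj ((h x y).trans (hmul x y).symm)
  · ext z
    exact hker z
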